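/- Let $\Omega\subset\mathbb R^d$ be a domain, i.e. a measurable set with nonempty connected interior and $\Omega\subset\overline{\operatorname{int}\Omega}$ (for instance a connected open set or its closure). Let $h:\mathbb R^d\to[0,\infty)$ be strictly convex, put $c(x,y)=h(x-y)$, and let $h^*(p)=\sup_z\,\langle z,p\rangle-h(z)$. Let $\mu,\nu$ be probability measures on $\Omega$. A transport plan is a measure $\gamma$ with marginals $\mu$ and $\nu$; it is optimal if it minimizes $\int c\,d\gamma$ among transport plans; a map $T$ is an optimal map from $\mu$ to $\nu$ if $(\mathrm{id}\times T)_\#\mu$ is an optimal plan. For $\psi:\Omega\to\mathbb R$ put $\psi^c(y)=\inf_{x\in\Omega}c(x,y)-\psi(x)$; $\psi$ is $c$-concave if $\psi(x)=\inf_{y\in\Omega}c(x,y)-\chi(y)$ on $\Omega$ for some $\chi:\Omega\to[-\infty,+\infty]$; a Kantorovich potential is a $c$-concave $\psi$ that maximizes $\int\psi\,d\mu+\int\psi^c\,d\nu$ among $c$-concave functions (with $\psi\in L^1(\mu)$, $\psi^c\in L^1(\nu)$). Gradients of functions on $\Omega$ are taken relative to $\Omega$ (the usual gradient at interior points). (1)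 There exists an optimal plan. Assume from now on that $\Omega$ is bounded. (2) There exists a Kantorovich potential. (3) If $\mu$ is absolutely continuous, the optimal plan is unique and of the form $(\mathrm{id}\times T)_\#\mu$ with $T$ measurable. For every Kantorovich potential $\psi$ and $\mu$-a.e. $x$: $\psi$ is differentiable at $x$, $h^*$ is finite near $\nabla\psi(x)$ and differentiable there, $T(x)=x-\nabla h^*(\nabla\psi(x))$, and $\psi(x)+\psi^c(T(x))=c(x,T(x))$. Any two Kantorovich potentials have the same gradient at $\mu$-a.e. $x$ such that $h$ is differentiable at $x-T(x)$; in particular, if $h$ is differentiable, $\nabla\psi$ is uniquely determined $\mu$-a.e. If $h$ is differentiable at $x-T(x)$ for $\mu$-a.e. $x$ (in particular if $h$ is differentiable) and the density of $\mu$ is positive a.e. on $\Omega$, then the Kantorovich potential is unique on $\Omega$ up to an additive constant. (4) Conversely, let $\psi$ be $c$-concave, and suppose that $\mu$ is absolutely continuous, or that $\mu$-a.e. point lies in the interior of $\Omega$ and is a point of differentiability of $\psi$. Then every map $T$ with $T(x)=x-\nabla h^*(\nabla\psi(x))$ for $\mu$-a.e. $x$ is an optimal map from $\mu$ to $T_\#\mu$.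 (5) (Brenier) If $\mu$ is absolutely continuous, then for the cost $|x-y|^2/2$ there is a convex $\varphi:\mathbb R^d\to\mathbb R$ such that $\nabla\varphi$ is an optimal map from $\mu$ to $\nu$; $\varphi=|x|^2/2-\psi$ on $\Omega$ for some Kantorovich potential $\psi$ for this cost, and $\nabla\varphi(x)=x-\nabla\psi(x)$ for $\mu$-a.e. $x$ for every such potential. Moreover $\nabla\varphi'=\nabla\varphi$ $\mu$-a.e. for every convex $\varphi':\mathbb R^d\to\mathbb R$ with $(\nabla\varphi')_\#\mu=\nu$. -/

import Mathlib

open MeasureTheory Set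
open scoped Gradient

namespace OptTransport

noncomputable section

/-- `ℝ^d` with its Euclidean norm and Lebesgue measure `volume`. -/
abbrev Space (d : ℕ) : Type := EuclideanSpace ℝ (Fin d)

/-- A domain, open or not: a measurable set lying between a nonempty connected open set
(its interior) and the closure of that open set. Open connected sets and their closures,
in particular compact domains, are the typical cases. -/
structure IsTransportDomain {d : ℕ} (Ω : Set (Space d)) : Prop where
  measurableSet : MeasurableSet Ω
  connected : IsConnected (interior Ω)
  subset_closure : Ω ⊆ closure (interior Ω)

/-- The cost `c(x, y) = h (x - y)`. -/
def diffCost {d : ℕ} (h : Space d → ℝ) (x y : Space d) : ℝ := h (x - y)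

/-- The quadratic profile `h z = |z|² / 2`. -/
def quadratic {d : ℕ} (z : Space d) : ℝ := ‖z‖ ^ 2 / 2

/-- `γ` is a transport plan from `μ` to `ν`: its two marginals are `μ` and `ν`. If `μ` and `ν` are
carried by `Ω`, then `γ` is carried by `Ω × Ω`. -/
def IsTransportPlan {d : ℕ} (μ ν : Measure (Space d)) (γ : Measure (Space d × Space d)) : Prop :=
  γ.map Prod.fst = μ ∧ γ.map Prod.snd = ν

/-- The total cost `∫ c dγ ∈ [0, ∞]` of a plan, for a nonnegative cost `c`. -/
def planCost {d : ℕ} (c : Space d → Space d → ℝ) (γ : Measure (Space d × Space d)) : ENNReal :=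
  ∫⁻ z, ENNReal.ofReal (c z.1 z.2) ∂γ

/-- `γ` solves the Kantorovich problem. -/
def IsOptimalPlan {d : ℕ} (c : Space d → Space d → ℝ) (μ ν : Measure (Space d))
    (γ : Measure (Space d × Space d)) : Prop :=
  IsTransportPlan μ ν γ ∧ ∀ γ', IsTransportPlan μ ν γ' → planCost c γ ≤ planCost c γ'

/-- The plan `(id × T)_# μ`. -/
def mapPlan {d : ℕ} (μ : Measure (Space d)) (T : Space d → Space d) :
    Measure (Space d × Space d) :=
  μ.map fun x => (x, T x)

/-- `T` is an optimal transport map from `μ` to `ν`. -/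
def IsOptimalMap {d : ℕ} (c : Space d → Space d → ℝ) (μ ν : Measure (Space d))
    (T : Space d → Space d) : Prop :=
  AEMeasurable T μ ∧ IsOptimalPlan c μ ν (mapPlan μ T)

/-- The `c`-transform `χ^c (y) = inf_{x ∈ Ω} c(x, y) - χ(x)` of an extended real function. -/
def cTransform {d : ℕ} (Ω : Set (Space d)) (c : Space d → Space d → ℝ) (χ : Space d → EReal)
    (y : Space d) : EReal :=
  ⨅ x ∈ Ω, ((c x y : ℝ) : EReal) - χ x

/-- A (finite) function `ψ` is `c`-concave on `Ω` if `ψ(x) = inf_{y ∈ Ω} c(x, y) - χ(y)` on `Ω` for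
some extended real function `χ`. For a symmetric cost this says `ψ = χ^c`; for other costs it is
the usual two-sided convention. Only the values of `ψ` on `Ω` matter. -/
def IsCConcave {d : ℕ} (Ω : Set (Space d)) (c : Space d → Space d → ℝ) (ψ : Space d → ℝ) : Prop :=
  ∃ χ : Space d → EReal, ∀ x ∈ Ω, (ψ x : EReal) = cTransform Ω (fun y x => c x y) χ x

/-- `ψ^c` for a real function `ψ`. -/
def cConj {d : ℕ} (Ω : Set (Space d)) (c : Space d → Space d → ℝ) (ψ : Space d → ℝ)
    (y : Space d) : EReal :=
  cTransform Ω c (fun x => (ψ x : EReal)) y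

/-- `ψ` is `c`-concave with `ψ ∈ L¹(μ)` and `ψ^c ∈ L¹(ν)`. -/
def IsDualAdmissible {d : ℕ} (Ω : Set (Space d)) (c : Space d → Space d → ℝ)
    (μ ν : Measure (Space d)) (ψ : Space d → ℝ) : Prop :=
  IsCConcave Ω c ψ ∧ Integrable ψ μ ∧
    (∀ᵐ y ∂ν, cConj Ω c ψ y ≠ ⊥ ∧ cConj Ω c ψ y ≠ ⊤) ∧
    Integrable (fun y => (cConj Ω c ψ y).toReal) ν

/-- The dual functional `∫ ψ dμ + ∫ ψ^c dν`. -/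
def dualValue {d : ℕ} (Ω : Set (Space d)) (c : Space d → Space d → ℝ)
    (μ ν : Measure (Space d)) (ψ : Space d → ℝ) : ℝ :=
  ∫ x, ψ x ∂μ + ∫ y, (cConj Ω c ψ y).toReal ∂ν

/-- Kantorovich potentials: the maximizers of the dual functional among `c`-concave functions. -/
def IsKantorovichPotential {d : ℕ} (Ω : Set (Space d)) (c : Space d → Space d → ℝ)
    (μ ν : Measure (Space d)) (ψ : Space d → ℝ) : Prop :=
  IsDualAdmissible Ω c μ ν ψ ∧
    ∀ φ, IsDualAdmissible Ω c μ ν φ → dualValue Ω c μ ν φ ≤ dualValue Ω c μ ν ψ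

/-- The set where the Legendre transform `h*` is finite. -/
def legendreDom {d : ℕ} (h : Space d → ℝ) : Set (Space d) :=
  {p | BddAbove (range fun z => inner ℝ z p - h z)}

/-- The Legendre transform `h*(p) = sup_z ⟨z, p⟩ - h(z)`, meaningful on `legendreDom h`. -/
def legendre {d : ℕ} (h : Space d → ℝ) (p : Space d) : ℝ :=
  ⨆ z, (inner ℝ z p - h z)

end

end OptTransport

/-!
Optimal plans exist by tightness of the set of plans and lower semicontinuity of the total cost.

On a bounded domain everything is read off from one object, the double transform of a `c`-concave
function: it agrees with the function on the domain, but is locally Lipschitz on the whole space,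
with the modulus of continuity of the cost. The equicontinuity gives Kantorovich potentials by
compactness, and Rademacher's theorem gives their differentiability almost everywhere.

If the double transform of `ψ` is differentiable at `x` and `y` minimizes `c(x, ·) - ψ^c`, then
`∇ψ(x)` is a subgradient of `h` at `x - y`. As `h` is strictly convex, `h*` is differentiable at
`∇ψ(x)` with gradient `x - y`, so the minimizer is the single point `T x = x - ∇h*(∇ψ(x))`.
Perturbing the potential in the dual problem shows that `T` pushes `μ` to `ν`. Hence `(id × T)_# μ`
satisfies `ψ + ψ^c = c`, which makes it optimal, and every other optimal plan satisfies the same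
equality, hence is carried by the graph of `T`.
-/

namespace OptTransport

open Filter Topology Metric
open scoped Pointwise NNReal

section Differentiation

variable {E : Type*} [NormedAddCommGroup E] [NormedSpace ℝ E]

theorem eq_of_ae_hasDerivAt_zero {f : ℝ → ℝ} (hf : LocallyLipschitz f) {a b : ℝ}
    (hd : ∀ᵐ t : ℝ, t ∈ uIcc a b → HasDerivAt f 0 t) : f a = f b := by
  obtain ⟨K, hK⟩ := LocallyLipschitzOn.exists_lipschitzOnWith_of_compact
    (isCompact_uIcc (a := a) (b := b)) hf.locallyLipschitzOn
  obtain ⟨C, hC⟩ := hK.absolutelyContinuousOnInterval.const_of_ae_hasDerivAt_zero hd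
  rw [hC a left_mem_uIcc, hC b right_mem_uIcc]

theorem eq_add_of_ae_hasFDerivAt_zero {f : E → ℝ} (hf : LocallyLipschitz f) {x v : E}
    (hd : ∀ᵐ t : ℝ, t ∈ Icc (0 : ℝ) 1 → HasFDerivAt f (0 : E →L[ℝ] ℝ) (x + t • v)) :
    f (x + v) = f x := by
  have hlip : LocallyLipschitz fun t : ℝ => f (x + t • v) :=
    hf.comp (show ContDiff ℝ 1 fun t : ℝ => x + t • v by fun_prop).locallyLipschitz
  have hline := eq_of_ae_hasDerivAt_zero hlip (a := 1) (b := 0) <| by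
    filter_upwards [hd] with t ht htI
    rw [uIcc_of_ge zero_le_one] at htI
    have hpath : HasDerivAt (fun t : ℝ => x + t • v) v t := by
      simpa using ((hasDerivAt_id t).smul_const v).const_add x
    simpa [Function.comp_def] using (ht htI).comp_hasDerivAt t hpath
  simpa using hline

variable [MeasurableSpace E] [BorelSpace E]

theorem ae_ae_add_smul [SecondCountableTopology E] (μ : Measure E) [SFinite μ]
    [μ.IsAddRightInvariant] {p : E → Prop} (hp : ∀ᵐ x ∂μ, p x) (v : E) :
    ∀ᵐ x ∂μ, ∀ᵐ t : ℝ, p (x + t • v) := by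
  obtain ⟨N, hsub, hNm, hN⟩ := exists_measurable_superset_of_null (ae_iff.1 hp)
  have htranslate : ∀ᵐ t : ℝ, ∀ᵐ x ∂μ, x + t • v ∉ N := by
    refine Eventually.of_forall fun t => ?_
    exact (measurePreserving_add_right μ (t • v)).quasiMeasurePreserving.ae
      (measure_eq_zero_iff_ae_notMem.1 hN)
  have hmeas : Measurable fun q : ℝ × E => q.2 + q.1 • v := by fun_prop
  filter_upwards [(Measure.ae_ae_comm (hmeas hNm).compl).1 htranslate] with x hx
  filter_upwards [hx] with t ht
  exact not_not.1 fun hpt => ht (hsub hpt)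

variable [FiniteDimensional ℝ E]

theorem eventually_eq_of_ae_hasFDerivAt_zero {f : E → ℝ} (μ : Measure E) [μ.IsAddHaarMeasure]
    (hf : LocallyLipschitz f) {x₀ : E} {r : ℝ} (hr : 0 < r)
    (hd : ∀ᵐ x ∂μ, x ∈ ball x₀ r → HasFDerivAt f (0 : E →L[ℝ] ℝ) x) :
    ∀ᶠ x in 𝓝 x₀, f x = f x₀ := by
  have htranslate : ∀ v ∈ ball (0 : E) (r / 2), f (x₀ + v) = f x₀ := by
    intro v hv
    have hae : (fun x => f (x + v)) =ᵐ[μ.restrict (ball x₀ (r / 2))] f := by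
      filter_upwards [ae_restrict_of_ae (ae_ae_add_smul μ hd v), ae_restrict_mem measurableSet_ball]
        with x hx hxb
      refine eq_add_of_ae_hasFDerivAt_zero hf ?_
      filter_upwards [hx] with t ht htI
      refine ht ?_
      have htv : ‖t • v‖ ≤ ‖v‖ := by
        rw [norm_smul, Real.norm_of_nonneg htI.1]
        exact mul_le_of_le_one_left (norm_nonneg v) htI.2
      rw [mem_ball_zero_iff] at hv
      rw [mem_ball_iff_norm] at hxb ⊢
      rw [add_sub_right_comm]
      linarith [norm_add_le (x - x₀) (t • v)]
    have hcont := hf.continuous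
    exact Measure.eqOn_open_of_ae_eq hae isOpen_ball (by fun_prop) hcont.continuousOn
      (mem_ball_self (half_pos hr))
  filter_upwards [ball_mem_nhds x₀ (half_pos hr)] with x hx
  simpa using htranslate (x - x₀) (mem_ball_zero_iff.2 (mem_ball_iff_norm.1 hx))

theorem exists_eq_const_of_ae_hasFDerivAt_zero {f : E → ℝ} (μ : Measure E)
    [μ.IsAddHaarMeasure] (hf : LocallyLipschitz f) {U : Set E} (hU : IsOpen U)
    (hUc : IsPreconnected U) (hd : ∀ᵐ x ∂μ, x ∈ U → HasFDerivAt f (0 : E →L[ℝ] ℝ) x) :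
    ∃ C, ∀ x ∈ U, f x = C := by
  have hderiv : ∀ x ∈ U, HasFDerivAt f (0 : E →L[ℝ] ℝ) x := by
    intro x hx
    obtain ⟨r, hr, hball⟩ := Metric.isOpen_iff.1 hU x hx
    refine (hasFDerivAt_const (f x) x).congr_of_eventuallyEq ?_
    exact eventually_eq_of_ae_hasFDerivAt_zero μ hf hr <|
      hd.mono fun y hy hyr => hy (hball hyr)
  exact hU.exists_is_const_of_fderiv_eq_zero hUc
    (fun x hx => (hderiv x hx).differentiableAt.differentiableWithinAt)
    fun x hx => (hderiv x hx).fderiv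

theorem uniqueDiffWithinAt_of_density_one (μ : Measure E) [μ.IsAddHaarMeasure] {s : Set E} {x : E}
    (hxs : x ∈ s)
    (hx : Tendsto (fun r => μ (s ∩ closedBall x r) / μ (closedBall x r)) (𝓝[>] 0) (𝓝 1)) :
    UniqueDiffWithinAt ℝ s x := by
  suffices tangentConeAt ℝ s x = univ from ⟨by simp [this], subset_closure hxs⟩
  refine eq_univ_of_forall fun z => ?_
  rw [tangentConeAt_eq_biInter_closure, mem_iInter₂]
  refine fun U hU => mem_closure_iff_nhds_basis nhds_basis_closedBall |>.2 fun ε hε => ?_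
  have hsmall : ∀ᶠ r in 𝓝[>] (0 : ℝ), {0} + r • closedBall z ε ⊆ U :=
    nhdsWithin_le_nhds (eventually_singleton_add_smul_subset isBounded_closedBall hU)
  have hmeet : ∀ᶠ r in 𝓝[>] (0 : ℝ), (s ∩ ({x} + r • closedBall z ε)).Nonempty :=
    Measure.eventually_nonempty_inter_smul_of_density_one μ s x hx _ measurableSet_closedBall
      (measure_closedBall_pos μ z hε).ne'
  obtain ⟨r, hrU, ⟨y, hys, hy⟩, hr⟩ := (hsmall.and (hmeet.and self_mem_nhdsWithin)).exists
  rw [singleton_add, image_add_left, mem_preimage] at hy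
  rw [singleton_add, image_add_left, neg_zero] at hrU
  obtain ⟨a, ha, hay : r • a = -x + y⟩ := hy
  have hxy : x + (-x + y) ∈ s := by simpa using hys
  refine ⟨a, mem_smul.2 ⟨r⁻¹, mem_univ _, -x + y, ⟨hrU ?_, hxy⟩, ?_⟩, ha⟩
  · simpa [← hay] using smul_mem_smul_set ha
  · rw [← hay, inv_smul_smul₀ (ne_of_gt hr)]

theorem ae_restrict_uniqueDiffWithinAt (μ : Measure E) [μ.IsAddHaarMeasure] {s : Set E}
    (hs : MeasurableSet s) : ∀ᵐ x ∂μ.restrict s, UniqueDiffWithinAt ℝ s x := by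
  filter_upwards [Besicovitch.ae_tendsto_measure_inter_div μ s, ae_restrict_mem hs] with x hx hxs
  exact uniqueDiffWithinAt_of_density_one μ hxs hx

theorem ae_differentiableAt_of_locallyLipschitz {f : E → ℝ} (μ : Measure E) [μ.IsAddHaarMeasure]
    (hf : LocallyLipschitz f) : ∀ᵐ x ∂μ, DifferentiableAt ℝ f x := by
  have hball : ∀ n : ℕ, ∀ᵐ x ∂μ, x ∈ ball (0 : E) n → DifferentiableAt ℝ f x := by
    intro n
    obtain ⟨K, hK⟩ := LocallyLipschitzOn.exists_lipschitzOnWith_of_compact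
      (isCompact_closedBall (0 : E) n) hf.locallyLipschitzOn
    filter_upwards [(hK.mono ball_subset_closedBall).ae_differentiableWithinAt_of_mem (μ := μ)]
      with x hx hxn
    exact (hx hxn).differentiableAt (isOpen_ball.mem_nhds hxn)
  filter_upwards [ae_all_iff.2 hball] with x hx
  obtain ⟨n, hn⟩ := exists_nat_gt ‖x‖
  exact hx n (by simpa using hn)

end Differentiation

section Subgradient

variable {E : Type*} [NormedAddCommGroup E] [InnerProductSpace ℝ E] {h : E → ℝ} {p z : E}

/-- `p` is a subgradient of `h` at `z`: the affine function of slope `p` through `(z, h z)` lies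
below `h`. The point varies as `z + v`, since the comparison functions are centred elsewhere. -/
def IsSubgradient (h : E → ℝ) (p z : E) : Prop :=
  ∀ v, h z + inner ℝ p v ≤ h (z + v)

theorem sub_le_smul_sub_of_convexOn (hh : ConvexOn ℝ univ h) (z v : E) {t : ℝ} (ht₀ : 0 ≤ t)
    (ht₁ : t ≤ 1) : h (z + t • v) - h z ≤ t * (h (z + v) - h z) := by
  have hconv := hh.2 (mem_univ z) (mem_univ (z + v)) (sub_nonneg.2 ht₁) ht₀ (by ring)
  rw [show (1 - t) • z + t • (z + v) = z + t • v by module] at hconv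
  simp only [smul_eq_mul] at hconv
  linarith

theorem isSubgradient_of_sub_le_sub [CompleteSpace E] {u : E → ℝ} {x : E}
    (hh : ConvexOn ℝ univ h) (hu : HasGradientAt u p x)
    (htouch : ∀ v, u (x + v) - u x ≤ h (z + v) - h z) : IsSubgradient h p z := by
  intro v
  have hslope := (hu.hasFDerivAt.hasLineDerivAt v).tendsto_slope_zero_right
  have hp : inner ℝ p v ≤ h (z + v) - h z := by
    refine le_of_tendsto hslope ?_
    filter_upwards [Ioc_mem_nhdsGT (zero_lt_one' ℝ)] with t ht
    rw [smul_eq_mul, inv_mul_le_iff₀ ht.1]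
    exact (htouch (t • v)).trans (sub_le_smul_sub_of_convexOn hh z v ht.1.le ht.2)
  linarith

theorem IsSubgradient.eq_gradient [CompleteSpace E] (hp : IsSubgradient h p z)
    (hd : DifferentiableAt ℝ h z) : p = ∇ h z := by
  have hmin : IsLocalMin (fun w => h w - inner ℝ p w) z := by
    refine Eventually.of_forall fun w => ?_
    have hw := hp (w - z)
    rw [inner_sub_right, add_sub_cancel] at hw
    linarith
  have hderiv : HasFDerivAt (fun w => h w - inner ℝ p w)
      (fderiv ℝ h z - InnerProductSpace.toDual ℝ E p) z :=
    hd.hasFDerivAt.sub (InnerProductSpace.toDual ℝ E p).hasFDerivAt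
  rw [gradient, sub_eq_zero.1 (hmin.hasFDerivAt_eq_zero hderiv),
    LinearIsometryEquiv.symm_apply_apply]

theorem IsSubgradient.add_inner_lt (hp : IsSubgradient h p z) (hh : StrictConvexOn ℝ univ h)
    {v : E} (hv : v ≠ 0) : h z + inner ℝ p v < h (z + v) := by
  have hmid := hh.2 (mem_univ z) (mem_univ (z + v)) (by simpa using hv)
    (one_half_pos (α := ℝ)) one_half_pos (add_halves 1)
  rw [show (1 / 2 : ℝ) • z + (1 / 2 : ℝ) • (z + v) = z + (1 / 2 : ℝ) • v by module] at hmid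
  have hhalf := hp ((1 / 2 : ℝ) • v)
  rw [inner_smul_right] at hhalf
  simp only [smul_eq_mul] at hmid
  linarith

theorem IsSubgradient.exists_forall_norm_eq_le [FiniteDimensional ℝ E] (hp : IsSubgradient h p z)
    (hh : StrictConvexOn ℝ univ h) {r : ℝ} (hr : 0 < r) :
    ∃ m > 0, ∀ v, ‖v‖ = r → m ≤ h (z + v) - h z - inner ℝ p v := by
  have hcont : Continuous h := hh.convexOn.locallyLipschitz.continuous
  rcases (sphere (0 : E) r).eq_empty_or_nonempty with hempty | hne
  · exact ⟨1, one_pos, fun v hv => (hempty.le (mem_sphere_zero_iff_norm.2 hv)).elim⟩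
  obtain ⟨v₀, hv₀, hmin⟩ := (isCompact_sphere (0 : E) r).exists_isMinOn hne
    (f := fun v => h (z + v) - h z - inner ℝ p v) (by fun_prop)
  have hv₀' : v₀ ≠ 0 := ne_of_mem_sphere hv₀ hr.ne'
  exact ⟨_, by linarith [hp.add_inner_lt hh hv₀'],
    fun v hv => hmin (mem_sphere_zero_iff_norm.2 hv)⟩

theorem IsSubgradient.exists_forall_le_norm_le [FiniteDimensional ℝ E] (hp : IsSubgradient h p z)
    (hh : StrictConvexOn ℝ univ h) {r : ℝ} (hr : 0 < r) :
    ∃ δ > 0, ∀ v, r ≤ ‖v‖ → δ * ‖v‖ ≤ h (z + v) - h z - inner ℝ p v := by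
  obtain ⟨m, hm, hsphere⟩ := hp.exists_forall_norm_eq_le hh hr
  refine ⟨m / r, by positivity, fun v hv => ?_⟩
  have hv₀ : 0 < ‖v‖ := hr.trans_le hv
  have hmin := hsphere ((r / ‖v‖) • v) (by
    rw [norm_smul, Real.norm_of_nonneg (by positivity), div_mul_cancel₀ _ hv₀.ne'])
  have hconv := sub_le_smul_sub_of_convexOn hh.convexOn z v
    (div_nonneg hr.le hv₀.le) ((div_le_one hv₀).2 hv)
  rw [inner_smul_right] at hmin
  calc m / r * ‖v‖ ≤ (r / ‖v‖ * (h (z + v) - h z - inner ℝ p v)) / r * ‖v‖ := by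
        gcongr; linarith
    _ = h (z + v) - h z - inner ℝ p v := by field_simp

end Subgradient

section Legendre

variable {d : ℕ} {h : Space d → ℝ} {p z : Space d}

theorem le_legendre (hp : p ∈ legendreDom h) (z : Space d) : inner ℝ z p - h z ≤ legendre h p :=
  le_ciSup (f := fun z => inner ℝ z p - h z) hp z

theorem IsSubgradient.inner_sub_le (hp : IsSubgradient h p z) (w : Space d) :
    inner ℝ w p - h w ≤ inner ℝ z p - h z := by
  have hw := hp (w - z)
  rw [inner_sub_right, add_sub_cancel, real_inner_comm w p, real_inner_comm z p] at hw
  linarith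

theorem IsSubgradient.legendre_eq (hp : IsSubgradient h p z) :
    legendre h p = inner ℝ z p - h z :=
  le_antisymm (ciSup_le hp.inner_sub_le) <|
    le_legendre ⟨_, forall_mem_range.2 hp.inner_sub_le⟩ z

/-- The supremum defining `legendre h q` only sees points close to `z` as `q → p`, which makes the
error term `r * ‖q - p‖` with `r` arbitrarily small. -/
theorem IsSubgradient.eventually_inner_sub_le (hp : IsSubgradient h p z)
    (hh : StrictConvexOn ℝ univ h) {r : ℝ} (hr : 0 < r) :
    ∀ᶠ q in 𝓝 p, ∀ w,
      inner ℝ w q - h w ≤ inner ℝ z p - h z + inner ℝ z (q - p) + r * ‖q - p‖ := by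
  obtain ⟨δ, hδ, hgrow⟩ := hp.exists_forall_le_norm_le hh hr
  filter_upwards [ball_mem_nhds p hδ] with q hq w
  rw [mem_ball_iff_norm] at hq
  obtain ⟨v, rfl⟩ : ∃ v, w = z + v := ⟨w - z, by abel⟩
  have hcs : inner ℝ v (q - p) ≤ ‖v‖ * ‖q - p‖ := real_inner_le_norm _ _
  have hexpand : inner ℝ (z + v) q
      = inner ℝ z p + inner ℝ z (q - p) + inner ℝ p v + inner ℝ v (q - p) := by
    rw [inner_sub_right, inner_sub_right, inner_add_left, real_inner_comm v p]; ring
  rcases le_total r ‖v‖ with hv | hv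
  · have hfar := hgrow v hv
    have hδv : ‖v‖ * ‖q - p‖ ≤ δ * ‖v‖ := by rw [mul_comm]; gcongr
    linarith [mul_nonneg hr.le (norm_nonneg (q - p))]
  · have hnear := hp v
    have hrv : ‖v‖ * ‖q - p‖ ≤ r * ‖q - p‖ := by gcongr
    linarith

theorem IsSubgradient.mem_interior_legendreDom (hp : IsSubgradient h p z)
    (hh : StrictConvexOn ℝ univ h) : p ∈ interior (legendreDom h) := by
  rw [mem_interior_iff_mem_nhds]
  filter_upwards [hp.eventually_inner_sub_le hh one_pos] with q hq
  exact ⟨_, forall_mem_range.2 hq⟩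

theorem IsSubgradient.hasGradientAt_legendre (hp : IsSubgradient h p z)
    (hh : StrictConvexOn ℝ univ h) : HasGradientAt (legendre h) z p := by
  rw [hasGradientAt_iff_isLittleO, Asymptotics.isLittleO_iff]
  intro r hr
  filter_upwards [hp.eventually_inner_sub_le hh hr,
    mem_interior_iff_mem_nhds.1 (hp.mem_interior_legendreDom hh)] with q hupper hq
  have hle : legendre h q ≤ inner ℝ z p - h z + inner ℝ z (q - p) + r * ‖q - p‖ := ciSup_le hupper
  have hge := le_legendre hq z
  rw [Real.norm_eq_abs, abs_le, hp.legendre_eq]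
  rw [inner_sub_right] at hle ⊢
  constructor <;> linarith [mul_nonneg hr.le (norm_nonneg (q - p))]

end Legendre

section InfTransform

open Function

variable {X Y : Type*}

/-- The transform `x ↦ inf_{y ∈ S} c(x, y) - f(y)` of a real function. The transform in the other
variable is `infTransform (flip c) S`. The value is meaningful when `S` is nonempty and
`c x · - f` is bounded below on `S`. -/
noncomputable def infTransform (c : X → Y → ℝ) (S : Set Y) (f : Y → ℝ) (x : X) : ℝ :=
  ⨅ y : S, (c x y - f y)

/-- The set of points `y` at which the infimum defining `infTransform c S f x` is attained, when it
is extended to the closure of `S`. -/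
def contactSet [TopologicalSpace Y] (c : X → Y → ℝ) (S : Set Y) (f : Y → ℝ) (x : X) : Set Y :=
  {y ∈ closure S | infTransform c S f x + f y = c x y}

/-- The uniform distance on `S` between the functions `c(x, ·)` and `c(x', ·)`. It is a modulus of
continuity common to all transforms of the cost `c`. -/
noncomputable def costModulus [TopologicalSpace Y] (c : X → Y → ℝ) (S : Set Y) (x x' : X) : ℝ :=
  sSup ((fun y => |c x y - c x' y|) '' closure S)

theorem continuous_uncurry_flip [TopologicalSpace X] [TopologicalSpace Y] {c : X → Y → ℝ}
    (hc : Continuous (uncurry c)) : Continuous (uncurry (flip c)) :=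
  hc.comp continuous_swap

section Order

variable {c : X → Y → ℝ} {S : Set Y} {f : Y → ℝ} {x : X}

theorem le_infTransform {a : ℝ} (hne : S.Nonempty) (ha : ∀ y ∈ S, a ≤ c x y - f y) :
    a ≤ infTransform c S f x :=
  have := hne.to_subtype
  le_ciInf fun y : S => ha y y.2

theorem infTransform_add_const (hne : S.Nonempty) (a : ℝ)
    (hf : BddBelow (range fun y : S => c x y - f y)) :
    infTransform c S (fun y => f y + a) x = infTransform c S f x - a := by
  have := hne.to_subtype
  simp only [infTransform, sub_add_eq_sub_sub]
  exact (ciInf_sub hf a).symm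

end Order

variable [TopologicalSpace X] [TopologicalSpace Y]
  {c : X → Y → ℝ} {S : Set Y} {f g : Y → ℝ} {x x' : X}

theorem bddAbove_image_of_isCompact_closure (hS : IsCompact (closure S)) (hf : Continuous f) :
    BddAbove (f '' S) :=
  (hS.bddAbove_image hf.continuousOn).mono (image_mono subset_closure)

theorem bddBelow_range_sub (hc : Continuous (uncurry c)) (hS : IsCompact (closure S))
    (hf : BddAbove (f '' S)) (x : X) : BddBelow (range fun y : S => c x y - f y) := by
  obtain ⟨m, hm⟩ := hS.bddBelow_image (f := c x) (by fun_prop)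
  obtain ⟨M, hM⟩ := hf
  refine ⟨m - M, forall_mem_range.2 fun y => sub_le_sub ?_ (hM (mem_image_of_mem f y.2))⟩
  exact hm (mem_image_of_mem _ (subset_closure y.2))

theorem infTransform_le (hc : Continuous (uncurry c)) (hS : IsCompact (closure S))
    (hf : BddAbove (f '' S)) (x : X) {y : Y} (hy : y ∈ S) : infTransform c S f x ≤ c x y - f y :=
  ciInf_le (bddBelow_range_sub hc hS hf x) (⟨y, hy⟩ : S)

theorem infTransform_le_add (hc : Continuous (uncurry c)) (hS : IsCompact (closure S))
    (hne : S.Nonempty) (hf : BddAbove (f '' S)) {a : ℝ}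
    (h : ∀ y ∈ S, c x y - f y ≤ c x' y - g y + a) :
    infTransform c S f x ≤ infTransform c S g x' + a :=
  sub_le_iff_le_add.1 <| le_infTransform hne fun y hy =>
    sub_le_iff_le_add.2 <| (infTransform_le hc hS hf x hy).trans (h y hy)

theorem abs_infTransform_sub_le (hc : Continuous (uncurry c)) (hS : IsCompact (closure S))
    (hne : S.Nonempty) (hf : BddAbove (f '' S)) (hg : BddAbove (g '' S)) {a : ℝ}
    (hfg : ∀ y ∈ S, |f y - g y| ≤ a) (x : X) :
    |infTransform c S f x - infTransform c S g x| ≤ a := by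
  refine abs_sub_le_iff.2 ⟨sub_le_iff_le_add'.2 ?_, sub_le_iff_le_add'.2 ?_⟩
  · exact infTransform_le_add hc hS hne hf fun y hy => by
      linarith [(abs_sub_le_iff.1 (hfg y hy)).2]
  · exact infTransform_le_add hc hS hne hg fun y hy => by
      linarith [(abs_sub_le_iff.1 (hfg y hy)).1]

theorem abs_sub_le_costModulus (hc : Continuous (uncurry c)) (hS : IsCompact (closure S))
    (x x' : X) {y : Y} (hy : y ∈ closure S) : |c x y - c x' y| ≤ costModulus c S x x' :=
  le_csSup (hS.bddAbove_image (by fun_prop)) (mem_image_of_mem _ hy)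

theorem tendsto_costModulus (hc : Continuous (uncurry c)) (hS : IsCompact (closure S))
    (hne : S.Nonempty) (x : X) : Tendsto (costModulus c S x) (𝓝 x) (𝓝 0) := by
  have hcont : Continuous (costModulus c S x) :=
    hS.continuous_sSup (f := fun x' y => |c x y - c x' y|) (by fun_prop)
  refine hcont.tendsto' x 0 ?_
  simp only [costModulus, sub_self, abs_zero, hne.closure.image_const, csSup_singleton]

theorem abs_infTransform_sub_le_costModulus (hc : Continuous (uncurry c))
    (hS : IsCompact (closure S)) (hne : S.Nonempty) (hf : BddAbove (f '' S)) (x x' : X) :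
    |infTransform c S f x - infTransform c S f x'| ≤ costModulus c S x x' := by
  have hmod : ∀ y ∈ S, |c x y - c x' y| ≤ costModulus c S x x' :=
    fun y hy => abs_sub_le_costModulus hc hS x x' (subset_closure hy)
  refine abs_sub_le_iff.2 ⟨sub_le_iff_le_add'.2 ?_, sub_le_iff_le_add'.2 ?_⟩
  · exact infTransform_le_add hc hS hne hf fun y hy => by
      linarith [(abs_sub_le_iff.1 (hmod y hy)).1]
  · exact infTransform_le_add hc hS hne hf fun y hy => by
      linarith [(abs_sub_le_iff.1 (hmod y hy)).2]

theorem continuous_of_abs_sub_le_costModulus (hc : Continuous (uncurry c))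
    (hS : IsCompact (closure S)) (hne : S.Nonempty) {u : X → ℝ}
    (hu : ∀ x x', |u x - u x'| ≤ costModulus c S x x') : Continuous u := by
  refine continuous_iff_continuousAt.2 fun x => tendsto_iff_dist_tendsto_zero.2 ?_
  refine squeeze_zero (fun _ => dist_nonneg) (fun x' => ?_) (tendsto_costModulus hc hS hne x)
  rw [dist_comm]
  exact hu x x'

theorem continuous_infTransform (hc : Continuous (uncurry c)) (hS : IsCompact (closure S))
    (hne : S.Nonempty) (hf : BddAbove (f '' S)) : Continuous (infTransform c S f) :=
  continuous_of_abs_sub_le_costModulus hc hS hne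
    (abs_infTransform_sub_le_costModulus hc hS hne hf)

theorem locallyLipschitz_infTransform {X Y : Type*} [PseudoMetricSpace X]
    [WeaklyLocallyCompactSpace X] [PseudoMetricSpace Y] {c : X → Y → ℝ} {S : Set Y} {f : Y → ℝ}
    (hc : LocallyLipschitz (uncurry c)) (hS : IsCompact (closure S)) (hne : S.Nonempty)
    (hf : BddAbove (f '' S)) : LocallyLipschitz (infTransform c S f) := by
  intro x₀
  obtain ⟨K, hK, hKx₀⟩ := exists_compact_mem_nhds x₀
  obtain ⟨L, hL⟩ := LocallyLipschitzOn.exists_lipschitzOnWith_of_compact (hK.prod hS)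
    hc.locallyLipschitzOn
  refine ⟨L, K, hKx₀, LipschitzOnWith.of_le_add_mul L fun x hx x' hx' => ?_⟩
  refine infTransform_le_add hc.continuous hS hne hf fun y hy => ?_
  have hy' := subset_closure hy
  have hxx' := hL.le_add_mul (mk_mem_prod hx hy') (mk_mem_prod hx' hy')
  simp only [uncurry, dist_prod_same_right] at hxx'
  linarith

theorem infTransform_add_le_of_mem_closure (hc : Continuous (uncurry c))
    (hS : IsCompact (closure S)) (hf : Continuous f) (x : X) {y : Y} (hy : y ∈ closure S) :
    infTransform c S f x + f y ≤ c x y := by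
  have hclosed : IsClosed {y | infTransform c S f x + f y ≤ c x y} :=
    isClosed_le (by fun_prop) (by fun_prop)
  refine closure_minimal (fun y hy => ?_) hclosed hy
  exact le_sub_iff_add_le.1
    (infTransform_le hc hS (bddAbove_image_of_isCompact_closure hS hf) x hy)

theorem nonempty_contactSet (hc : Continuous (uncurry c)) (hS : IsCompact (closure S))
    (hne : S.Nonempty) (hf : Continuous f) (x : X) : (contactSet c S f x).Nonempty := by
  obtain ⟨y, hy, hmin⟩ := hS.exists_isMinOn hne.closure
    (f := fun y => c x y - f y) (by fun_prop)
  refine ⟨y, hy, le_antisymm (infTransform_add_le_of_mem_closure hc hS hf x hy) ?_⟩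
  exact sub_le_iff_le_add.1 (le_infTransform hne fun y' hy' => hmin (subset_closure hy'))

/-- The transform `inf_{y ∈ S} c(x, y) - ψ^c(y)` of the transform `ψ^c` of `ψ`: the smallest
`c`-concave function above `ψ` on `S`, defined and regular on the whole space. -/
noncomputable def biTransform (c : X → X → ℝ) (S : Set X) (ψ : X → ℝ) : X → ℝ :=
  infTransform c S (infTransform (flip c) S ψ)

/-- Away from the contact set `c x · - f` exceeds its infimum by a definite amount, which absorbs a
small perturbation of `f`. -/
theorem eventually_infTransform_sub_mul_le (hc : Continuous (uncurry c))
    (hS : IsCompact (closure S)) (hne : S.Nonempty) (hf : Continuous f) (hg : Continuous g) {b : ℝ}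
    (hb : ∀ y ∈ contactSet c S f x, g y < b) :
    ∀ᶠ ε in 𝓝[>] (0 : ℝ),
      infTransform c S f x - ε * b ≤ infTransform c S (fun y => f y + ε * g y) x := by
  have hK : IsCompact (closure S ∩ {y | b ≤ g y}) :=
    hS.inter_right (isClosed_le continuous_const hg)
  have hgap : ∀ y ∈ closure S ∩ {y | b ≤ g y}, 0 < c x y - f y - infTransform c S f x := by
    rintro y ⟨hy, hby⟩
    have hle := infTransform_add_le_of_mem_closure hc hS hf x hy
    have hne : infTransform c S f x + f y ≠ c x y := fun heq => (hb y ⟨hy, heq⟩).not_ge hby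
    linarith [hle.lt_of_ne hne]
  obtain ⟨m, hm, hmK⟩ := hK.exists_forall_le' (f := fun y => c x y - f y - infTransform c S f x)
    (by fun_prop) hgap
  obtain ⟨M, hM⟩ := bddAbove_image_of_isCompact_closure hS hg
  have hsmall : ∀ᶠ ε in 𝓝[>] (0 : ℝ), ε * (M - b) < m := by
    refine nhdsWithin_le_nhds (Tendsto.eventually_lt_const hm ?_)
    exact (continuous_mul_const (M - b)).tendsto' 0 0 (zero_mul _)
  filter_upwards [hsmall, self_mem_nhdsWithin] with ε hεm hε
  refine le_infTransform hne fun y hy => ?_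
  rcases lt_or_ge (g y) b with hgy | hgy
  · have hle := infTransform_add_le_of_mem_closure hc hS hf x (subset_closure hy)
    nlinarith [mul_lt_mul_of_pos_left hgy hε]
  · have hle := hmK y ⟨subset_closure hy, hgy⟩
    nlinarith [mul_le_mul_of_nonneg_left (hM (mem_image_of_mem g hy)) (le_of_lt hε)]

/-- Envelope theorem: only the contact points matter to first order, and here there is only one. -/
theorem tendsto_infTransform_add_mul (hc : Continuous (uncurry c)) (hS : IsCompact (closure S))
    (hne : S.Nonempty) (hf : Continuous f) (hg : Continuous g) {y₀ : Y}
    (hy₀ : contactSet c S f x = {y₀}) :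
    Tendsto (fun ε => (infTransform c S f x - infTransform c S (fun y => f y + ε * g y) x) / ε)
      (𝓝[>] 0) (𝓝 (g y₀)) := by
  have hmem : y₀ ∈ contactSet c S f x := hy₀ ▸ mem_singleton y₀
  refine tendsto_order.2 ⟨fun a ha => ?_, fun b hb => ?_⟩
  · filter_upwards [self_mem_nhdsWithin] with ε hε
    have hle := infTransform_add_le_of_mem_closure hc hS
      (f := fun y => f y + ε * g y) (by fun_prop) x hmem.1
    rw [← hmem.2] at hle
    rw [lt_div_iff₀ hε]
    nlinarith [mul_lt_mul_of_pos_right ha hε]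
  · obtain ⟨b', hb'⟩ := exists_between hb
    filter_upwards [eventually_infTransform_sub_mul_le hc hS hne hf hg
      (fun y hy => (hy₀ ▸ hy : y ∈ ({y₀} : Set Y)) ▸ hb'.1), self_mem_nhdsWithin] with ε hle hε
    rw [div_lt_iff₀ hε]
    nlinarith [mul_lt_mul_of_pos_right hb'.2 hε]

section BiTransform

variable {c : X → X → ℝ} {S : Set X} {ψ : X → ℝ}

theorem continuous_infTransform_flip (hc : Continuous (uncurry c)) (hS : IsCompact (closure S))
    (hne : S.Nonempty) (hψ : BddAbove (ψ '' S)) : Continuous (infTransform (flip c) S ψ) :=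
  continuous_infTransform (continuous_uncurry_flip hc) hS hne hψ

theorem continuous_biTransform (hc : Continuous (uncurry c)) (hS : IsCompact (closure S))
    (hne : S.Nonempty) (hψ : BddAbove (ψ '' S)) : Continuous (biTransform c S ψ) :=
  continuous_infTransform hc hS hne <|
    bddAbove_image_of_isCompact_closure hS (continuous_infTransform_flip hc hS hne hψ)

theorem locallyLipschitz_biTransform {X : Type*} [PseudoMetricSpace X]
    [WeaklyLocallyCompactSpace X] {c : X → X → ℝ} {S : Set X} {ψ : X → ℝ}
    (hc : LocallyLipschitz (uncurry c)) (hS : IsCompact (closure S)) (hne : S.Nonempty)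
    (hψ : BddAbove (ψ '' S)) : LocallyLipschitz (biTransform c S ψ) :=
  locallyLipschitz_infTransform hc hS hne <|
    bddAbove_image_of_isCompact_closure hS (continuous_infTransform_flip hc.continuous hS hne hψ)

theorem le_biTransform (hc : Continuous (uncurry c)) (hS : IsCompact (closure S))
    (hψ : BddAbove (ψ '' S)) {x : X} (hx : x ∈ S) : ψ x ≤ biTransform c S ψ x := by
  refine le_infTransform ⟨x, hx⟩ fun y _ => ?_
  have hle := infTransform_le (continuous_uncurry_flip hc) hS hψ y hx
  simp only [flip] at hle
  linarith

theorem mem_contactSet_of_mem_contactSet_flip (hc : Continuous (uncurry c))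
    (hS : IsCompact (closure S)) (hψ : Continuous ψ) {x y : X} (hx : x ∈ S) (hy : y ∈ closure S)
    (hxy : x ∈ contactSet (flip c) S ψ y) : y ∈ contactSet c S (infTransform (flip c) S ψ) x := by
  have hbdd := bddAbove_image_of_isCompact_closure hS hψ
  have hcont := continuous_infTransform_flip hc hS ⟨x, hx⟩ hbdd
  refine ⟨hy, le_antisymm (infTransform_add_le_of_mem_closure hc hS hcont x hy) ?_⟩
  have heq : infTransform (flip c) S ψ y + ψ x = c x y := hxy.2
  have hle : ψ x ≤ infTransform c S (infTransform (flip c) S ψ) x := le_biTransform hc hS hbdd hx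
  linarith

end BiTransform

end InfTransform

section CConcave

variable {d : ℕ} {c : Space d → Space d → ℝ} {S : Set (Space d)} {f ψ : Space d → ℝ}

open Function

theorem cTransform_coe (hc : Continuous (uncurry c)) (hS : IsCompact (closure S))
    (hne : S.Nonempty) (hf : BddAbove (f '' S)) (y : Space d) :
    cTransform S c (fun x => (f x : EReal)) y = infTransform (flip c) S f y := by
  refine le_antisymm (le_of_forall_gt_imp_ge_of_dense fun b hb => ?_) (le_iInf₂ fun x hx => ?_)
  · induction b with
    | bot => exact absurd hb not_lt_bot
    | top => exact le_top
    | coe b =>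
      have := hne.to_subtype
      obtain ⟨x, hx⟩ := exists_lt_of_ciInf_lt (EReal.coe_lt_coe_iff.1 hb)
      refine (iInf₂_le (x : Space d) x.2).trans ?_
      rw [← EReal.coe_sub, EReal.coe_le_coe_iff]
      exact hx.le
  · rw [← EReal.coe_sub, EReal.coe_le_coe_iff]
    exact infTransform_le (continuous_uncurry_flip hc) hS hf y hx

theorem toReal_cConj (hc : Continuous (uncurry c)) (hS : IsCompact (closure S))
    (hne : S.Nonempty) (hψ : BddAbove (ψ '' S)) (y : Space d) :
    (cConj S c ψ y).toReal = infTransform (flip c) S ψ y := by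
  rw [cConj, cTransform_coe hc hS hne hψ, EReal.toReal_coe]

theorem isCConcave_infTransform (hc : Continuous (uncurry c)) (hS : IsCompact (closure S))
    (hne : S.Nonempty) (hf : BddAbove (f '' S)) : IsCConcave S c (infTransform c S f) :=
  ⟨fun y => (f y : EReal),
    fun x _ => (cTransform_coe (continuous_uncurry_flip hc) hS hne hf x).symm⟩

theorem IsCConcave.exists_isGLB (hψ : IsCConcave S c ψ) : ∃ G ⊆ S ×ˢ (univ : Set ℝ),
    ∀ x ∈ S, IsGLB ((fun q : Space d × ℝ => c x q.1 - q.2) '' G) (ψ x) := by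
  obtain ⟨χ, hχ⟩ := hψ
  have hle : ∀ x ∈ S, ∀ y ∈ S, (ψ x : EReal) ≤ (c x y : EReal) - χ y :=
    fun x hx y hy => (hχ x hx).trans_le (iInf₂_le y hy)
  refine ⟨{q | q.1 ∈ S ∧ χ q.1 = q.2}, fun q hq => ⟨hq.1, mem_univ _⟩, fun x hx => ⟨?_, ?_⟩⟩
  · rintro _ ⟨q, ⟨hqS, hq⟩, rfl⟩
    have hxq := hle x hx q.1 hqS
    rw [hq] at hxq
    exact_mod_cast hxq
  · intro b hb
    rw [← EReal.coe_le_coe_iff, hχ x hx]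
    refine le_iInf₂ fun y hy => ?_
    cases hy' : χ y with
    | bot => simp
    | top => simpa [hy'] using hle x hx y hy
    | coe r => exact_mod_cast hb ⟨(y, r), ⟨hy, hy'⟩, rfl⟩

theorem IsCConcave.bddAbove_image (hψ : IsCConcave S c ψ) (hc : Continuous (uncurry c))
    (hS : IsCompact (closure S)) : BddAbove (ψ '' S) := by
  rcases S.eq_empty_or_nonempty with rfl | ⟨x₀, hx₀⟩
  · simp
  obtain ⟨G, -, hG⟩ := hψ.exists_isGLB
  obtain ⟨⟨y, r⟩, hyr⟩ := (hG x₀ hx₀).nonempty.of_image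
  obtain ⟨M, hM⟩ := bddAbove_image_of_isCompact_closure hS (f := (c · y)) (by fun_prop)
  refine ⟨M - r, forall_mem_image.2 fun x hx => ?_⟩
  exact ((hG x hx).1 (mem_image_of_mem _ hyr)).trans
    (sub_le_sub_right (hM (mem_image_of_mem _ hx)) r)

theorem IsCConcave.eqOn_biTransform (hψ : IsCConcave S c ψ) (hc : Continuous (uncurry c))
    (hS : IsCompact (closure S)) : EqOn ψ (biTransform c S ψ) S := by
  intro x hx
  have hbdd := hψ.bddAbove_image hc hS
  have hbdd' := bddAbove_image_of_isCompact_closure hS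
    (continuous_infTransform_flip hc hS ⟨x, hx⟩ hbdd)
  refine le_antisymm (le_biTransform hc hS hbdd hx) ?_
  obtain ⟨G, hGS, hG⟩ := hψ.exists_isGLB
  refine (hG x hx).2 ?_
  rintro _ ⟨⟨y, r⟩, hyr, rfl⟩
  refine (infTransform_le hc hS hbdd' x (hGS hyr).1).trans (sub_le_sub_left ?_ _)
  exact le_infTransform ⟨x, hx⟩ fun x' hx' =>
    le_sub_comm.1 ((hG x' hx').1 (mem_image_of_mem _ hyr))

end CConcave

section Duality

variable {d : ℕ} {c : Space d → Space d → ℝ} {μ ν : Measure (Space d)}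
  {γ γ₀ : Measure (Space d × Space d)} {A B : Set (Space d)} {u v : Space d → ℝ}

theorem IsTransportPlan.measurePreserving_fst (hγ : IsTransportPlan μ ν γ) :
    MeasurePreserving Prod.fst γ μ :=
  ⟨measurable_fst, hγ.1⟩

theorem IsTransportPlan.measurePreserving_snd (hγ : IsTransportPlan μ ν γ) :
    MeasurePreserving Prod.snd γ ν :=
  ⟨measurable_snd, hγ.2⟩

theorem IsTransportPlan.ae_mem_prod (hγ : IsTransportPlan μ ν γ) (hμ : ∀ᵐ x ∂μ, x ∈ A)
    (hν : ∀ᵐ y ∂ν, y ∈ B) : ∀ᵐ z ∂γ, z ∈ A ×ˢ B :=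
  (hγ.measurePreserving_fst.quasiMeasurePreserving.ae hμ).and
    (hγ.measurePreserving_snd.quasiMeasurePreserving.ae hν)

theorem isTransportPlan_mapPlan {T : Space d → Space d} (hT : AEMeasurable T μ) :
    IsTransportPlan μ (μ.map T) (mapPlan μ T) :=
  ⟨(Measure.fst_map_prodMk₀ hT).trans Measure.map_id, Measure.snd_map_prodMk₀ aemeasurable_id⟩

theorem IsTransportPlan.integrable_add (hγ : IsTransportPlan μ ν γ) (hu : Integrable u μ)
    (hv : Integrable v ν) : Integrable (fun z => u z.1 + v z.2) γ :=
  (hγ.measurePreserving_fst.integrable_comp_of_integrable hu).add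
    (hγ.measurePreserving_snd.integrable_comp_of_integrable hv)

theorem IsTransportPlan.integral_add (hγ : IsTransportPlan μ ν γ) (hu : Integrable u μ)
    (hv : Integrable v ν) : ∫ z, (u z.1 + v z.2) ∂γ = ∫ x, u x ∂μ + ∫ y, v y ∂ν := by
  have hfst : Integrable (fun z => u z.1) γ :=
    hγ.measurePreserving_fst.integrable_comp_of_integrable hu
  have hsnd : Integrable (fun z => v z.2) γ :=
    hγ.measurePreserving_snd.integrable_comp_of_integrable hv
  rw [MeasureTheory.integral_add hfst hsnd]
  congr 1
  · rw [← hγ.1, integral_map measurable_fst.aemeasurable (hγ.1.symm ▸ hu.1)]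
  · rw [← hγ.2, integral_map measurable_snd.aemeasurable (hγ.2.symm ▸ hv.1)]

theorem ofReal_integral_le_lintegral_ofReal {X : Type*} [MeasurableSpace X] {μ : Measure X}
    {f : X → ℝ} (hf : Integrable f μ) :
    ENNReal.ofReal (∫ x, f x ∂μ) ≤ ∫⁻ x, ENNReal.ofReal (f x) ∂μ := by
  rw [integral_eq_lintegral_pos_part_sub_lintegral_neg_part hf]
  exact (ENNReal.ofReal_le_ofReal (sub_le_self _ ENNReal.toReal_nonneg)).trans
    ENNReal.ofReal_toReal_le

theorem IsTransportPlan.ofReal_integral_add_le_planCost (hγ : IsTransportPlan μ ν γ)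
    (hμ : ∀ᵐ x ∂μ, x ∈ A) (hν : ∀ᵐ y ∂ν, y ∈ B) (hu : Integrable u μ) (hv : Integrable v ν)
    (huv : ∀ x ∈ A, ∀ y ∈ B, u x + v y ≤ c x y) :
    ENNReal.ofReal (∫ x, u x ∂μ + ∫ y, v y ∂ν) ≤ planCost c γ := by
  rw [← hγ.integral_add hu hv]
  refine (ofReal_integral_le_lintegral_ofReal (hγ.integrable_add hu hv)).trans ?_
  refine lintegral_mono_ae ?_
  filter_upwards [hγ.ae_mem_prod hμ hν] with z hz
  exact ENNReal.ofReal_le_ofReal (huv z.1 hz.1 z.2 hz.2)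

theorem IsTransportPlan.planCost_eq_of_contact (hγ : IsTransportPlan μ ν γ)
    (hc₀ : ∀ x y, 0 ≤ c x y) (hu : Integrable u μ) (hv : Integrable v ν)
    (hcontact : ∀ᵐ z ∂γ, u z.1 + v z.2 = c z.1 z.2) :
    planCost c γ = ENNReal.ofReal (∫ x, u x ∂μ + ∫ y, v y ∂ν) := by
  have hnonneg : 0 ≤ᵐ[γ] fun z => u z.1 + v z.2 :=
    hcontact.mono fun z hz => (hc₀ z.1 z.2).trans_eq hz.symm
  rw [← hγ.integral_add hu hv,
    ofReal_integral_eq_lintegral_ofReal (hγ.integrable_add hu hv) hnonneg]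
  exact lintegral_congr_ae (hcontact.mono fun z hz => congrArg ENNReal.ofReal hz.symm)

theorem IsTransportPlan.isOptimalPlan_of_contact (hγ : IsTransportPlan μ ν γ)
    (hc₀ : ∀ x y, 0 ≤ c x y) (hμ : ∀ᵐ x ∂μ, x ∈ A) (hν : ∀ᵐ y ∂ν, y ∈ B)
    (hu : Integrable u μ) (hv : Integrable v ν) (huv : ∀ x ∈ A, ∀ y ∈ B, u x + v y ≤ c x y)
    (hcontact : ∀ᵐ z ∂γ, u z.1 + v z.2 = c z.1 z.2) : IsOptimalPlan c μ ν γ :=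
  ⟨hγ, fun _ hγ' => (hγ.planCost_eq_of_contact hc₀ hu hv hcontact).trans_le
    (hγ'.ofReal_integral_add_le_planCost hμ hν hu hv huv)⟩

/-- Complementary slackness: contact along one plan forces contact along every optimal plan. -/
theorem IsOptimalPlan.ae_contact (hγ : IsOptimalPlan c μ ν γ) (hc : Measurable (Function.uncurry c))
    (hc₀ : ∀ x y, 0 ≤ c x y) (hμ : ∀ᵐ x ∂μ, x ∈ A) (hν : ∀ᵐ y ∂ν, y ∈ B)
    (hu : Integrable u μ) (hv : Integrable v ν) (huv : ∀ x ∈ A, ∀ y ∈ B, u x + v y ≤ c x y)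
    (hγ₀ : IsTransportPlan μ ν γ₀) (hcontact : ∀ᵐ z ∂γ₀, u z.1 + v z.2 = c z.1 z.2) :
    ∀ᵐ z ∂γ, u z.1 + v z.2 = c z.1 z.2 := by
  have hvalue : 0 ≤ ∫ x, u x ∂μ + ∫ y, v y ∂ν := by
    rw [← hγ₀.integral_add hu hv]
    exact integral_nonneg_of_ae (hcontact.mono fun z hz => (hc₀ z.1 z.2).trans_eq hz.symm)
  have hcost : planCost c γ ≤ ENNReal.ofReal (∫ x, u x ∂μ + ∫ y, v y ∂ν) :=
    (hγ.2 γ₀ hγ₀).trans_eq (hγ₀.planCost_eq_of_contact hc₀ hu hv hcontact)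
  have hnonneg : 0 ≤ᵐ[γ] Function.uncurry c := Eventually.of_forall fun z => hc₀ z.1 z.2
  have hint : Integrable (Function.uncurry c) γ :=
    ⟨hc.aestronglyMeasurable,
      (hasFiniteIntegral_iff_ofReal hnonneg).2 (hcost.trans_lt ENNReal.ofReal_lt_top)⟩
  have hle : (fun z => u z.1 + v z.2) ≤ᵐ[γ] Function.uncurry c := by
    filter_upwards [hγ.1.ae_mem_prod hμ hν] with z hz using huv z.1 hz.1 z.2 hz.2
  have hsum := hγ.1.integrable_add hu hv
  refine (integral_eq_iff_of_ae_le hsum hint hle).1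
    (le_antisymm (integral_mono_ae hsum hint hle) ?_)
  rw [integral_eq_lintegral_of_nonneg_ae hnonneg hint.1, hγ.1.integral_add hu hv]
  exact ENNReal.toReal_le_of_le_ofReal hvalue hcost

end Duality

section ExistenceOfPlans

theorem continuous_lintegral_ofReal_min {X : Type*} [MeasurableSpace X] [TopologicalSpace X]
    [OpensMeasurableSpace X] {g : X → ℝ} (hg : Continuous g) (n : ℕ) :
    Continuous fun γ : ProbabilityMeasure X =>
      ∫⁻ z, min (ENNReal.ofReal (g z)) n ∂(γ : Measure X) := by
  let F : BoundedContinuousFunction X ℝ≥0 :=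
    .mkOfBound ⟨fun z => min (g z).toNNReal n, by fun_prop⟩ n fun x y =>
      abs_sub_le_of_nonneg_of_le NNReal.zero_le_coe (NNReal.coe_le_coe.2 (min_le_right _ _))
        NNReal.zero_le_coe (NNReal.coe_le_coe.2 (min_le_right _ _))
  have hF : ∀ z, (F z : ENNReal) = min (ENNReal.ofReal (g z)) n := fun z =>
    ENNReal.coe_min _ _
  simp only [← hF]
  exact continuous_iff_continuousAt.2 fun γ =>
    ProbabilityMeasure.tendsto_iff_forall_lintegral_tendsto.1 tendsto_id F

theorem lowerSemicontinuous_lintegral_ofReal {X : Type*} [MeasurableSpace X] [TopologicalSpace X]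
    [OpensMeasurableSpace X] {g : X → ℝ} (hg : Continuous g) :
    LowerSemicontinuous fun γ : ProbabilityMeasure X =>
      ∫⁻ z, ENNReal.ofReal (g z) ∂(γ : Measure X) := by
  have hsup : ∀ γ : ProbabilityMeasure X, ∫⁻ z, ENNReal.ofReal (g z) ∂(γ : Measure X) =
      ⨆ n : ℕ, ∫⁻ z, min (ENNReal.ofReal (g z)) n ∂(γ : Measure X) := fun γ => by
    rw [← lintegral_iSup (f := fun n z => min (ENNReal.ofReal (g z)) (n : ℕ))
      (fun n => hg.measurable.ennreal_ofReal.min measurable_const)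
      fun m n hmn z => min_le_min_left _ (Nat.cast_le.2 hmn)]
    simp only [← inf_iSup_eq, ENNReal.iSup_natCast, inf_top_eq]
  simp only [hsup]
  exact lowerSemicontinuous_iSup fun n => (continuous_lintegral_ofReal_min hg n).lowerSemicontinuous

variable {d : ℕ} (μ ν : Measure (Space d)) [IsProbabilityMeasure μ] [IsProbabilityMeasure ν]

theorem isTightMeasureSet_setOf_isTransportPlan :
    IsTightMeasureSet {γ : Measure (Space d × Space d) | IsTransportPlan μ ν γ} := by
  refine IsTightMeasureSet.prodMk ?_ ?_
  · refine (isTightMeasureSet_singleton (μ := μ)).subset ?_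
    rintro _ ⟨γ, hγ, rfl⟩
    exact hγ.1
  · refine (isTightMeasureSet_singleton (μ := ν)).subset ?_
    rintro _ ⟨γ, hγ, rfl⟩
    exact hγ.2

theorem isClosed_setOf_isTransportPlan :
    IsClosed {γ : ProbabilityMeasure (Space d × Space d) | IsTransportPlan μ ν γ} := by
  let μ' : ProbabilityMeasure (Space d) := ⟨μ, inferInstance⟩
  let ν' : ProbabilityMeasure (Space d) := ⟨ν, inferInstance⟩
  have hset : {γ : ProbabilityMeasure (Space d × Space d) | IsTransportPlan μ ν γ} =
      (fun γ => γ.map continuous_fst.measurable.aemeasurable) ⁻¹' {μ'} ∩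
        (fun γ => γ.map continuous_snd.measurable.aemeasurable) ⁻¹' {ν'} := by
    ext γ
    exact ⟨fun hγ => ⟨Subtype.ext hγ.1, Subtype.ext hγ.2⟩,
      fun hγ => ⟨congrArg Subtype.val hγ.1, congrArg Subtype.val hγ.2⟩⟩
  rw [hset]
  exact (isClosed_singleton.preimage (ProbabilityMeasure.continuous_map continuous_fst)).inter
    (isClosed_singleton.preimage (ProbabilityMeasure.continuous_map continuous_snd))

theorem isCompact_setOf_isTransportPlan :
    IsCompact {γ : ProbabilityMeasure (Space d × Space d) | IsTransportPlan μ ν γ} := by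
  rw [← (isClosed_setOf_isTransportPlan μ ν).closure_eq]
  refine isCompact_closure_of_isTightMeasureSet ?_
  refine (isTightMeasureSet_setOf_isTransportPlan μ ν).subset ?_
  rintro _ ⟨γ, hγ, rfl⟩
  exact hγ

theorem exists_isOptimalPlan {c : Space d → Space d → ℝ} (hc : Continuous (Function.uncurry c)) :
    ∃ γ, IsOptimalPlan c μ ν γ := by
  have hprod : IsTransportPlan μ ν (μ.prod ν) := by simp [IsTransportPlan]
  obtain ⟨γ, hγ, hmin⟩ := LowerSemicontinuousOn.exists_isMinOn ⟨⟨μ.prod ν, inferInstance⟩, hprod⟩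
    (isCompact_setOf_isTransportPlan μ ν)
    ((lowerSemicontinuous_lintegral_ofReal hc).lowerSemicontinuousOn _)
  refine ⟨γ, hγ, fun γ' hγ' => ?_⟩
  have : IsProbabilityMeasure (γ'.map Prod.fst) := by rw [hγ'.1]; infer_instance
  have hγ'_prob : IsProbabilityMeasure γ' :=
    (Measure.isProbabilityMeasure_map_iff measurable_fst.aemeasurable).1 this
  exact hmin (show (⟨γ', hγ'_prob⟩ : ProbabilityMeasure (Space d × Space d)) ∈ _ from hγ')

end ExistenceOfPlans

section ExistenceOfPotentials

open Function

theorem isCompact_setOf_abs_sub_le_costModulus {X Y : Type*} [TopologicalSpace X]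
    [TopologicalSpace Y] {c : X → Y → ℝ} {S : Set Y} (hc : Continuous (uncurry c))
    (hS : IsCompact (closure S)) (hne : S.Nonempty) (x₀ : X) :
    IsCompact {g : C(X, ℝ) | g x₀ = 0 ∧ ∀ x x', |g x - g x'| ≤ costModulus c S x x'} := by
  refine ArzelaAscoli.isCompact_of_equicontinuous _ ?_ fun x => ?_
  · have himage : ContinuousMap.toFun '' {g : C(X, ℝ) |
        g x₀ = 0 ∧ ∀ x x', |g x - g x'| ≤ costModulus c S x x'} =
        {u | u x₀ = 0 ∧ ∀ x x', |u x - u x'| ≤ costModulus c S x x'} := by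
      refine Subset.antisymm (image_subset_iff.2 fun g hg => hg) fun u hu => ?_
      exact ⟨⟨u, continuous_of_abs_sub_le_costModulus hc hS hne hu.2⟩, hu, rfl⟩
    rw [himage]
    refine (isCompact_univ_pi fun x => isCompact_closedBall (0 : ℝ)
      (costModulus c S x x₀)).of_isClosed_subset ?_ fun u hu x _ => ?_
    · simp only [ofPred_and, ofPred_forall]
      refine (isClosed_eq (by fun_prop) continuous_const).inter ?_
      exact isClosed_iInter fun x => isClosed_iInter fun x' =>
        isClosed_le (by fun_prop) continuous_const
    · simpa [hu.1] using hu.2 x x₀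
  · exact Metric.equicontinuousAt_of_continuity_modulus _ (tendsto_costModulus hc hS hne x) _
      (Eventually.of_forall fun x' g => g.2.2 x x')

theorem integrable_of_continuous {X : Type*} [TopologicalSpace X] [MeasurableSpace X]
    [OpensMeasurableSpace X] {μ : Measure X} [IsFiniteMeasure μ] {S : Set X} {f : X → ℝ}
    (hS : IsCompact (closure S)) (hμ : ∀ᵐ x ∂μ, x ∈ S) (hf : Continuous f) : Integrable f μ := by
  have hint : IntegrableOn f (closure S) μ :=
    hf.continuousOn.integrableOn_compact' hS isClosed_closure.measurableSet
  rwa [IntegrableOn, Measure.restrict_eq_self_of_ae_mem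
    (hμ.mono fun x hx => subset_closure hx)] at hint

variable {d : ℕ} {c : Space d → Space d → ℝ} {S : Set (Space d)} {μ ν : Measure (Space d)}
  {f g ψ : Space d → ℝ}

theorem dualValue_eq (hc : Continuous (uncurry c)) (hS : IsCompact (closure S))
    (hne : S.Nonempty) (hψ : BddAbove (ψ '' S)) :
    dualValue S c μ ν ψ = ∫ x, ψ x ∂μ + ∫ y, infTransform (flip c) S ψ y ∂ν := by
  simp only [dualValue, toReal_cConj hc hS hne hψ]

theorem dualValue_congr (hμ : ∀ᵐ x ∂μ, x ∈ S) (hfg : EqOn f g S) :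
    dualValue S c μ ν f = dualValue S c μ ν g := by
  have hconj : cConj S c f = cConj S c g := by
    funext y
    exact iInf_congr fun x => iInf_congr fun hx => by simp only [hfg hx]
  simp only [dualValue, hconj]
  rw [integral_congr_ae (hμ.mono hfg)]

theorem IsCConcave.isDualAdmissible [IsFiniteMeasure μ] [IsFiniteMeasure ν]
    (hψ : IsCConcave S c ψ) (hc : Continuous (uncurry c)) (hS : IsCompact (closure S))
    (hne : S.Nonempty) (hμ : ∀ᵐ x ∂μ, x ∈ S) (hν : ∀ᵐ y ∂ν, y ∈ S) :
    IsDualAdmissible S c μ ν ψ := by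
  have hbdd := hψ.bddAbove_image hc hS
  have hconj := continuous_infTransform_flip hc hS hne hbdd
  have hbi := continuous_biTransform hc hS hne hbdd
  refine ⟨hψ, ?_, Eventually.of_forall fun y => ?_, ?_⟩
  · exact (integrable_of_continuous hS hμ hbi).congr
      (hμ.mono fun x hx => (hψ.eqOn_biTransform hc hS hx).symm)
  · rw [cConj, cTransform_coe hc hS hne hbdd]
    exact ⟨EReal.coe_ne_bot _, EReal.coe_ne_top _⟩
  · simpa only [toReal_cConj hc hS hne hbdd] using integrable_of_continuous hS hν hconj

theorem integral_add_integral_le_dualValue_infTransform [IsFiniteMeasure ν]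
    (hc : Continuous (uncurry c)) (hS : IsCompact (closure S)) (hne : S.Nonempty)
    (hν : ∀ᵐ y ∂ν, y ∈ S) (hf : Continuous f) :
    ∫ x, infTransform c S f x ∂μ + ∫ y, f y ∂ν ≤ dualValue S c μ ν (infTransform c S f) := by
  have hbdd := bddAbove_image_of_isCompact_closure hS hf
  have hbdd' := bddAbove_image_of_isCompact_closure hS (continuous_infTransform hc hS hne hbdd)
  have hc' := continuous_uncurry_flip hc
  rw [dualValue_eq hc hS hne hbdd']
  refine add_le_add_right (integral_mono_ae (integrable_of_continuous hS hν hf)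
    (integrable_of_continuous hS hν (continuous_infTransform hc' hS hne hbdd')) ?_) _
  filter_upwards [hν] with y hy using le_biTransform hc' hS hbdd hy

theorem dualValue_le_dualValue_biTransform [IsFiniteMeasure μ] [IsFiniteMeasure ν]
    (hc : Continuous (uncurry c)) (hS : IsCompact (closure S)) (hne : S.Nonempty)
    (hμ : ∀ᵐ x ∂μ, x ∈ S) (hν : ∀ᵐ y ∂ν, y ∈ S) (hf : Continuous f) :
    dualValue S c μ ν f ≤ dualValue S c μ ν (biTransform c S f) := by
  have hbdd := bddAbove_image_of_isCompact_closure hS hf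
  have hconj := continuous_infTransform_flip hc hS hne hbdd
  have hbi := continuous_biTransform hc hS hne hbdd
  rw [dualValue_eq hc hS hne hbdd]
  refine le_trans (add_le_add_left (integral_mono_ae (integrable_of_continuous hS hμ hf)
    (integrable_of_continuous hS hμ hbi) ?_) _)
    (integral_add_integral_le_dualValue_infTransform hc hS hne hν hconj)
  filter_upwards [hμ] with x hx using le_biTransform hc hS hbdd hx

theorem dualValue_add_const [IsProbabilityMeasure μ] [IsProbabilityMeasure ν]
    (hc : Continuous (uncurry c)) (hS : IsCompact (closure S)) (hne : S.Nonempty)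
    (hμ : ∀ᵐ x ∂μ, x ∈ S) (hν : ∀ᵐ y ∂ν, y ∈ S) (hf : Continuous f) (a : ℝ) :
    dualValue S c μ ν (fun x => f x + a) = dualValue S c μ ν f := by
  have hc' := continuous_uncurry_flip hc
  have hbdd := bddAbove_image_of_isCompact_closure hS hf
  have hbdd' : BddAbove ((fun x => f x + a) '' S) :=
    bddAbove_image_of_isCompact_closure hS (by fun_prop)
  have hconj := continuous_infTransform hc' hS hne hbdd
  rw [dualValue_eq hc hS hne hbdd, dualValue_eq hc hS hne hbdd']
  simp only [fun y => infTransform_add_const hne a (bddBelow_range_sub hc' hS hbdd y)]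
  rw [integral_add (integrable_of_continuous hS hμ hf) (integrable_const a),
    integral_sub (integrable_of_continuous hS hν hconj) (integrable_const a)]
  simp only [integral_const, probReal_univ, one_smul]
  ring

theorem abs_integral_sub_le {X : Type*} [MeasurableSpace X] {μ : Measure X}
    [IsProbabilityMeasure μ] {f g : X → ℝ} {a : ℝ} (hf : Integrable f μ) (hg : Integrable g μ)
    (hfg : ∀ᵐ x ∂μ, |f x - g x| ≤ a) : |∫ x, f x ∂μ - ∫ x, g x ∂μ| ≤ a := by
  rw [← integral_sub hf hg]
  simpa using norm_integral_le_of_norm_le_const (μ := μ) (f := fun x => f x - g x) hfg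

theorem abs_dualValue_sub_le [IsProbabilityMeasure μ] [IsProbabilityMeasure ν]
    (hc : Continuous (uncurry c)) (hS : IsCompact (closure S)) (hne : S.Nonempty)
    (hμ : ∀ᵐ x ∂μ, x ∈ S) (hν : ∀ᵐ y ∂ν, y ∈ S) (hf : Continuous f) (hg : Continuous g) {a : ℝ}
    (hfg : ∀ x ∈ S, |f x - g x| ≤ a) :
    |dualValue S c μ ν f - dualValue S c μ ν g| ≤ 2 * a := by
  have hc' := continuous_uncurry_flip hc
  have hfb := bddAbove_image_of_isCompact_closure hS hf
  have hgb := bddAbove_image_of_isCompact_closure hS hg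
  rw [dualValue_eq hc hS hne hfb, dualValue_eq hc hS hne hgb, add_sub_add_comm, two_mul]
  refine (abs_add_le _ _).trans (add_le_add ?_ ?_)
  · exact abs_integral_sub_le (integrable_of_continuous hS hμ hf)
      (integrable_of_continuous hS hμ hg) (hμ.mono hfg)
  · exact abs_integral_sub_le
      (integrable_of_continuous hS hν (continuous_infTransform hc' hS hne hfb))
      (integrable_of_continuous hS hν (continuous_infTransform hc' hS hne hgb))
      (Eventually.of_forall (abs_infTransform_sub_le hc' hS hne hfb hgb hfg))

theorem continuous_dualValue [IsProbabilityMeasure μ] [IsProbabilityMeasure ν]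
    (hc : Continuous (uncurry c)) (hS : IsCompact (closure S)) (hne : S.Nonempty)
    (hμ : ∀ᵐ x ∂μ, x ∈ S) (hν : ∀ᵐ y ∂ν, y ∈ S) :
    Continuous fun g : C(Space d, ℝ) => dualValue S c μ ν g := by
  refine continuous_iff_continuousAt.2 fun g => Metric.tendsto_nhds.2 fun ε hε => ?_
  have hunif := Metric.tendstoUniformlyOn_iff.1
    (ContinuousMap.tendsto_iff_forall_isCompact_tendstoUniformlyOn.1 (tendsto_id (x := 𝓝 g)) _ hS)
    (ε / 3) (by positivity)
  filter_upwards [hunif] with g' hg'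
  have hclose : ∀ x ∈ S, |g' x - g x| ≤ ε / 3 := fun x hx => by
    rw [abs_sub_comm]
    exact (hg' x (subset_closure hx)).le
  have hdual := abs_dualValue_sub_le (μ := μ) (ν := ν) hc hS hne hμ hν g'.continuous g.continuous
    hclose
  rw [Real.dist_eq]
  linarith

/-- The transforms have the common modulus of continuity `costModulus`, so that once normalized at
a point they form a compact family, on which the dual functional attains its maximum. -/
theorem exists_isKantorovichPotential [IsProbabilityMeasure μ] [IsProbabilityMeasure ν]
    (hc : Continuous (uncurry c)) (hS : IsCompact (closure S)) (hμ : ∀ᵐ x ∂μ, x ∈ S)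
    (hν : ∀ᵐ y ∂ν, y ∈ S) : ∃ ψ, IsKantorovichPotential S c μ ν ψ := by
  obtain ⟨x₀, hx₀⟩ := hμ.exists
  have hne : S.Nonempty := ⟨x₀, hx₀⟩
  have hbdd : ∀ f, BddAbove (f '' S) → BddAbove (infTransform (flip c) S f '' S) := fun f hf =>
    bddAbove_image_of_isCompact_closure hS (continuous_infTransform_flip hc hS hne hf)
  have hmod₀ : ∀ x x', 0 ≤ costModulus c S x x' := fun x x' =>
    (abs_nonneg _).trans (abs_sub_le_costModulus hc hS x x' (subset_closure hx₀))
  obtain ⟨g, -, hmax⟩ := (isCompact_setOf_abs_sub_le_costModulus hc hS hne x₀).exists_isMaxOn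
    ⟨0, rfl, by simpa using hmod₀⟩ (continuous_dualValue (μ := μ) hc hS hne hμ hν).continuousOn
  have hg := bddAbove_image_of_isCompact_closure hS g.continuous
  refine ⟨biTransform c S g, (isCConcave_infTransform hc hS hne (hbdd g hg)).isDualAdmissible
    hc hS hne hμ hν, fun φ hφ => ?_⟩
  have hφbdd := hbdd φ (hφ.1.bddAbove_image hc hS)
  have hφcont : Continuous (biTransform c S φ) := continuous_infTransform hc hS hne hφbdd
  let normalized : C(Space d, ℝ) :=
    ⟨fun x => biTransform c S φ x + -biTransform c S φ x₀, by fun_prop⟩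
  have hnormalized : normalized x₀ = 0 ∧
      ∀ x x', |normalized x - normalized x'| ≤ costModulus c S x x' :=
    ⟨add_neg_cancel _, fun x x' => by
      simpa [normalized, biTransform] using
        abs_infTransform_sub_le_costModulus hc hS hne hφbdd x x'⟩
  calc dualValue S c μ ν φ
      = dualValue S c μ ν (biTransform c S φ) := dualValue_congr hμ (hφ.1.eqOn_biTransform hc hS)
    _ = dualValue S c μ ν normalized := (dualValue_add_const hc hS hne hμ hν hφcont _).symm
    _ ≤ dualValue S c μ ν g := hmax hnormalized
    _ ≤ dualValue S c μ ν (biTransform c S g) :=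
      dualValue_le_dualValue_biTransform hc hS hne hμ hν g.continuous

end ExistenceOfPotentials

section FirstVariation

open Function

variable {d : ℕ} {c : Space d → Space d → ℝ} {S : Set (Space d)} {μ ν : Measure (Space d)}
  [IsProbabilityMeasure μ] [IsProbabilityMeasure ν] {ψ g : Space d → ℝ} {T : Space d → Space d}

theorem IsKantorovichPotential.integral_le_integral_infTransform_sub_div
    (hψ : IsKantorovichPotential S c μ ν ψ) (hc : Continuous (uncurry c))
    (hS : IsCompact (closure S)) (hμ : ∀ᵐ x ∂μ, x ∈ S) (hν : ∀ᵐ y ∂ν, y ∈ S) (hg : Continuous g)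
    {ε : ℝ} (hε : 0 < ε) :
    ∫ y, g y ∂ν ≤ ∫ x, (biTransform c S ψ x -
      infTransform c S (fun y => infTransform (flip c) S ψ y + ε * g y) x) / ε ∂μ := by
  have hne : S.Nonempty := hμ.exists
  have hψbdd := hψ.1.1.bddAbove_image hc hS
  have hconj := continuous_infTransform_flip hc hS hne hψbdd
  have hpert : Continuous fun y => infTransform (flip c) S ψ y + ε * g y := by fun_prop
  have hpertbdd := bddAbove_image_of_isCompact_closure hS hpert
  have hbi := integrable_of_continuous hS hμ (continuous_biTransform hc hS hne hψbdd)
  have hdual : ∫ x, infTransform c S (fun y => infTransform (flip c) S ψ y + ε * g y) x ∂μ +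
      ∫ y, (infTransform (flip c) S ψ y + ε * g y) ∂ν ≤
        ∫ x, biTransform c S ψ x ∂μ + ∫ y, infTransform (flip c) S ψ y ∂ν := by
    refine (integral_add_integral_le_dualValue_infTransform hc hS hne hν hpert).trans ?_
    refine (hψ.2 _ ((isCConcave_infTransform hc hS hne hpertbdd).isDualAdmissible
      hc hS hne hμ hν)).trans_eq ?_
    rw [dualValue_eq hc hS hne hψbdd,
      integral_congr_ae (hμ.mono (hψ.1.1.eqOn_biTransform hc hS))]
  rw [integral_add (integrable_of_continuous hS hν hconj)
    ((integrable_of_continuous hS hν hg).const_mul ε), integral_const_mul] at hdual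
  rw [integral_div, le_div_iff₀ hε, integral_sub hbi
    (integrable_of_continuous hS hμ (continuous_infTransform hc hS hne hpertbdd))]
  linarith

theorem IsKantorovichPotential.integral_le_integral_comp
    (hψ : IsKantorovichPotential S c μ ν ψ) (hc : Continuous (uncurry c))
    (hS : IsCompact (closure S)) (hμ : ∀ᵐ x ∂μ, x ∈ S) (hν : ∀ᵐ y ∂ν, y ∈ S)
    (hT : ∀ᵐ x ∂μ, contactSet c S (infTransform (flip c) S ψ) x = {T x}) {M : ℝ}
    (hg : Continuous g) (hgM : ∀ y, |g y| ≤ M) : ∫ y, g y ∂ν ≤ ∫ x, g (T x) ∂μ := by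
  have hne : S.Nonempty := hμ.exists
  have hconj := continuous_infTransform_flip hc hS hne (hψ.1.1.bddAbove_image hc hS)
  have hpert : ∀ ε : ℝ, Continuous fun y => infTransform (flip c) S ψ y + ε * g y :=
    fun ε => by fun_prop
  have hbdd := bddAbove_image_of_isCompact_closure hS hconj
  have hpertbdd := fun ε => bddAbove_image_of_isCompact_closure hS (hpert ε)
  suffices hlim : Tendsto (fun ε => ∫ x, (biTransform c S ψ x -
      infTransform c S (fun y => infTransform (flip c) S ψ y + ε * g y) x) / ε ∂μ)
      (𝓝[>] 0) (𝓝 (∫ x, g (T x) ∂μ)) from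
    ge_of_tendsto hlim (eventually_mem_nhdsWithin.mono fun ε hε =>
      hψ.integral_le_integral_infTransform_sub_div hc hS hμ hν hg hε)
  refine tendsto_integral_filter_of_dominated_convergence (fun _ => M)
    (Eventually.of_forall fun ε => ?_) ?_ (integrable_const M) ?_
  · exact (((continuous_infTransform hc hS hne hbdd).sub
      (continuous_infTransform hc hS hne (hpertbdd ε))).div_const ε).aestronglyMeasurable
  · filter_upwards [self_mem_nhdsWithin] with ε (hε : 0 < ε)
    refine Eventually.of_forall fun x => ?_
    rw [Real.norm_eq_abs, abs_div, abs_of_pos hε, div_le_iff₀ hε]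
    refine abs_infTransform_sub_le hc hS hne hbdd (hpertbdd ε) (fun y _ => ?_) x
    rw [sub_add_cancel_left, abs_neg, abs_mul, abs_of_pos hε, mul_comm]
    exact mul_le_mul_of_nonneg_right (hgM y) hε.le
  · exact hT.mono fun x hx => tendsto_infTransform_add_mul hc hS hne hconj hg hx

/-- The Euler–Lagrange equation of the dual problem: varying the transform `ψ^c` in the direction
`g` gives `∫ g dν = ∫ g ∘ T dμ`. -/
theorem IsKantorovichPotential.map_eq (hψ : IsKantorovichPotential S c μ ν ψ)
    (hc : Continuous (uncurry c)) (hS : IsCompact (closure S)) (hμ : ∀ᵐ x ∂μ, x ∈ S)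
    (hν : ∀ᵐ y ∂ν, y ∈ S) (hTm : AEMeasurable T μ)
    (hT : ∀ᵐ x ∂μ, contactSet c S (infTransform (flip c) S ψ) x = {T x}) : μ.map T = ν := by
  have hle : ∀ g : BoundedContinuousFunction (Space d) ℝ, ∫ y, g y ∂ν ≤ ∫ x, g (T x) ∂μ :=
    fun g => hψ.integral_le_integral_comp hc hS hμ hν hT g.continuous g.norm_coe_le_norm
  have := Measure.isProbabilityMeasure_map hTm
  refine ext_of_forall_integral_eq_of_IsFiniteMeasure fun g => ?_
  rw [integral_map hTm g.continuous.aestronglyMeasurable]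
  refine le_antisymm ?_ (hle g)
  have hneg := hle (-g)
  simp only [BoundedContinuousFunction.coe_neg, Pi.neg_apply, integral_neg] at hneg
  exact neg_le_neg_iff.1 hneg

end FirstVariation

section OptimalMaps

open Function

variable {d : ℕ} {c : Space d → Space d → ℝ} {S : Set (Space d)} {μ ν : Measure (Space d)}
  {f ψ : Space d → ℝ} {T T' : Space d → Space d} {γ : Measure (Space d × Space d)}

theorem ae_mapPlan_iff (hT : AEMeasurable T μ) {p : Space d × Space d → Prop}
    (hp : MeasurableSet {z | p z}) : (∀ᵐ z ∂mapPlan μ T, p z) ↔ ∀ᵐ x ∂μ, p (x, T x) :=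
  ae_map_iff (aemeasurable_id'.prodMk hT) hp

theorem ae_eq_of_mapPlan_eq (hT : Measurable T) (hT' : AEMeasurable T' μ)
    (heq : mapPlan μ T' = mapPlan μ T) : T' =ᵐ[μ] T := by
  have hgraph : MeasurableSet {z : Space d × Space d | z.2 = T z.1} :=
    measurableSet_eq_fun measurable_snd (hT.comp measurable_fst)
  refine (ae_mapPlan_iff hT' hgraph).1 ?_
  rw [heq]
  exact (ae_mapPlan_iff hT.aemeasurable hgraph).2 (Eventually.of_forall fun _ => rfl)

theorem IsTransportPlan.eq_mapPlan (hγ : IsTransportPlan μ ν γ) (hT : Measurable T)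
    (hgraph : ∀ᵐ z ∂γ, z.2 = T z.1) : γ = mapPlan μ T :=
  calc γ = γ.map id := Measure.map_id.symm
    _ = γ.map ((fun x => (x, T x)) ∘ Prod.fst) :=
        Measure.map_congr (hgraph.mono fun _ hz => Prod.ext rfl hz)
    _ = mapPlan μ T := by
        rw [← Measure.map_map (measurable_id'.prodMk hT) measurable_fst, hγ.1, mapPlan]

theorem ae_mapPlan_contact (hc : Continuous (uncurry c)) (hS : IsCompact (closure S))
    (hne : S.Nonempty) (hf : Continuous f) (hT : AEMeasurable T μ)
    (hcontact : ∀ᵐ x ∂μ, T x ∈ contactSet c S f x) :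
    ∀ᵐ z ∂mapPlan μ T, infTransform c S f z.1 + f z.2 = c z.1 z.2 := by
  have hu := continuous_infTransform hc hS hne (bddAbove_image_of_isCompact_closure hS hf)
  have hclosed : IsClosed {z : Space d × Space d | infTransform c S f z.1 + f z.2 = c z.1 z.2} :=
    isClosed_eq (by fun_prop) hc
  exact (ae_mapPlan_iff hT hclosed.measurableSet).2 (hcontact.mono fun x hx => hx.2)

theorem isOptimalMap_of_mem_contactSet [IsFiniteMeasure μ] (hc : Continuous (uncurry c))
    (hc₀ : ∀ x y, 0 ≤ c x y) (hS : IsCompact (closure S)) (hne : S.Nonempty)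
    (hμ : ∀ᵐ x ∂μ, x ∈ S) (hf : Continuous f) (hT : AEMeasurable T μ)
    (hcontact : ∀ᵐ x ∂μ, T x ∈ contactSet c S f x) : IsOptimalMap c μ (μ.map T) T := by
  have hu := continuous_infTransform hc hS hne (bddAbove_image_of_isCompact_closure hS hf)
  have hcarrier : ∀ᵐ y ∂μ.map T, y ∈ closure S :=
    (ae_map_iff hT isClosed_closure.measurableSet).2 (hcontact.mono fun x hx => hx.1)
  refine ⟨hT, (isTransportPlan_mapPlan hT).isOptimalPlan_of_contact hc₀ hμ hcarrier
    (integrable_of_continuous hS hμ hu)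
    (integrable_of_continuous (by rwa [closure_closure]) hcarrier hf)
    (fun x _ y hy => infTransform_add_le_of_mem_closure hc hS hf x hy)
    (ae_mapPlan_contact hc hS hne hf hT hcontact)⟩

theorem IsCConcave.add_cConj_eq (hψ : IsCConcave S c ψ) (hc : Continuous (uncurry c))
    (hS : IsCompact (closure S)) {x y : Space d} (hx : x ∈ S)
    (hy : y ∈ contactSet c S (infTransform (flip c) S ψ) x) :
    (ψ x : EReal) + cConj S c ψ y = (c x y : ℝ) := by
  rw [cConj, cTransform_coe hc hS ⟨x, hx⟩ (hψ.bddAbove_image hc hS), hψ.eqOn_biTransform hc hS hx]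
  exact_mod_cast hy.2

section Potential

variable [IsProbabilityMeasure μ] [IsProbabilityMeasure ν]

theorem IsKantorovichPotential.isOptimalMap (hψ : IsKantorovichPotential S c μ ν ψ)
    (hc : Continuous (uncurry c)) (hc₀ : ∀ x y, 0 ≤ c x y) (hS : IsCompact (closure S))
    (hμ : ∀ᵐ x ∂μ, x ∈ S) (hν : ∀ᵐ y ∂ν, y ∈ S) (hTm : AEMeasurable T μ)
    (hT : ∀ᵐ x ∂μ, contactSet c S (infTransform (flip c) S ψ) x = {T x}) :
    IsOptimalMap c μ ν T := by
  have hconj := continuous_infTransform_flip hc hS hμ.exists (hψ.1.1.bddAbove_image hc hS)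
  have hopt := isOptimalMap_of_mem_contactSet hc hc₀ hS hμ.exists hμ hconj hTm
    (hT.mono fun x hx => hx ▸ mem_singleton (T x))
  rwa [hψ.map_eq hc hS hμ hν hTm hT] at hopt

theorem IsKantorovichPotential.eq_mapPlan (hψ : IsKantorovichPotential S c μ ν ψ)
    (hc : Continuous (uncurry c)) (hc₀ : ∀ x y, 0 ≤ c x y) (hS : IsCompact (closure S))
    (hμ : ∀ᵐ x ∂μ, x ∈ S) (hν : ∀ᵐ y ∂ν, y ∈ S) (hTm : Measurable T)
    (hT : ∀ᵐ x ∂μ, contactSet c S (infTransform (flip c) S ψ) x = {T x})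
    (hγ : IsOptimalPlan c μ ν γ) : γ = mapPlan μ T := by
  have hψbdd := hψ.1.1.bddAbove_image hc hS
  have hconj := continuous_infTransform_flip hc hS hμ.exists hψbdd
  have hbi := continuous_biTransform hc hS hμ.exists hψbdd
  have hplan := (hψ.isOptimalMap hc hc₀ hS hμ hν hTm.aemeasurable hT).2.1
  have hν' : ∀ᵐ y ∂ν, y ∈ closure S := hν.mono fun y hy => subset_closure hy
  have hcontact := hγ.ae_contact hc.measurable hc₀ hμ hν'
    (integrable_of_continuous hS hμ hbi) (integrable_of_continuous hS hν hconj)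
    (fun x _ y hy => infTransform_add_le_of_mem_closure hc hS hconj x hy) hplan
    (ae_mapPlan_contact hc hS hμ.exists hconj hTm.aemeasurable
      (hT.mono fun x hx => hx ▸ mem_singleton (T x)))
  refine hγ.1.eq_mapPlan hTm ?_
  filter_upwards [hcontact, hγ.1.measurePreserving_fst.quasiMeasurePreserving.ae hT,
    hγ.1.measurePreserving_snd.quasiMeasurePreserving.ae hν'] with z hz hzT hzS
  exact mem_singleton_iff.1 (hzT ▸ (⟨hzS, hz⟩ : z.2 ∈ contactSet c S _ z.1))

theorem IsKantorovichPotential.ae_eq_of_isOptimalMap (hψ : IsKantorovichPotential S c μ ν ψ)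
    (hc : Continuous (uncurry c)) (hc₀ : ∀ x y, 0 ≤ c x y) (hS : IsCompact (closure S))
    (hμ : ∀ᵐ x ∂μ, x ∈ S) (hν : ∀ᵐ y ∂ν, y ∈ S) (hTm : Measurable T)
    (hT : ∀ᵐ x ∂μ, contactSet c S (infTransform (flip c) S ψ) x = {T x})
    (hT' : IsOptimalMap c μ ν T') : T' =ᵐ[μ] T :=
  ae_eq_of_mapPlan_eq hTm hT'.1 (hψ.eq_mapPlan hc hc₀ hS hμ hν hTm hT hT'.2)

end Potential

end OptimalMaps

section DifferenceCosts

open Function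

variable {d : ℕ} {h : Space d → ℝ} {S : Set (Space d)} {μ ν : Measure (Space d)}
  {f u u₁ u₂ ψ ψ₁ ψ₂ : Space d → ℝ} {T : Space d → Space d} {x y : Space d}

/-- The map `x ↦ x - ∇h*(∇u(x))`, which is the candidate optimal map for a potential `u` and the
cost `diffCost h`. -/
noncomputable def gradientMap (h u : Space d → ℝ) (x : Space d) : Space d :=
  x - ∇ (legendre h) (∇ u x)

theorem measurable_gradient (u : Space d → ℝ) : Measurable (∇ u) :=
  (InnerProductSpace.toDual ℝ (Space d)).symm.continuous.measurable.comp (measurable_fderiv ℝ u)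

theorem measurable_gradientMap (h u : Space d → ℝ) : Measurable (gradientMap h u) :=
  measurable_id.sub ((measurable_gradient _).comp (measurable_gradient u))

theorem locallyLipschitz_uncurry_diffCost (hh : LocallyLipschitz h) :
    LocallyLipschitz (uncurry (diffCost h)) :=
  hh.comp (LipschitzWith.prod_fst.sub LipschitzWith.prod_snd).locallyLipschitz

theorem isSubgradient_gradient_infTransform (hh : ConvexOn ℝ univ h) (hS : IsCompact (closure S))
    (hf : Continuous f) (hd : DifferentiableAt ℝ (infTransform (diffCost h) S f) x)
    (hy : y ∈ contactSet (diffCost h) S f x) :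
    IsSubgradient h (∇ (infTransform (diffCost h) S f) x) (x - y) := by
  refine isSubgradient_of_sub_le_sub hh hd.hasGradientAt fun v => ?_
  have hle := infTransform_add_le_of_mem_closure
    (locallyLipschitz_uncurry_diffCost hh.locallyLipschitz).continuous hS hf (x + v) hy.1
  have heq := hy.2
  simp only [diffCost, add_sub_right_comm] at hle heq
  linarith

theorem contactSet_eq_singleton_gradientMap (hh : StrictConvexOn ℝ univ h)
    (hS : IsCompact (closure S)) (hne : S.Nonempty) (hf : Continuous f)
    (hd : DifferentiableAt ℝ (infTransform (diffCost h) S f) x) :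
    contactSet (diffCost h) S f x = {gradientMap h (infTransform (diffCost h) S f) x} := by
  have hc := (locallyLipschitz_uncurry_diffCost hh.convexOn.locallyLipschitz).continuous
  refine eq_singleton_iff_nonempty_unique_mem.2 ⟨nonempty_contactSet hc hS hne hf x, fun y hy => ?_⟩
  have hp := isSubgradient_gradient_infTransform hh.convexOn hS hf hd hy
  rw [gradientMap, (hp.hasGradientAt_legendre hh).gradient, sub_sub_cancel]

theorem gradientWithin_eq_gradient_of_eqOn (hψ : EqOn ψ u S) (hx : x ∈ S)
    (hS : UniqueDiffWithinAt ℝ S x) (hu : DifferentiableAt ℝ u x) :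
    gradientWithin ψ S x = ∇ u x := by
  rw [gradientWithin, fderivWithin_congr hψ (hψ hx), hu.fderivWithin hS, gradient]

theorem exists_eq_add_const_of_ae_gradient_eq (hS : IsTransportDomain S) (hu₁ : LocallyLipschitz u₁)
    (hu₂ : LocallyLipschitz u₂) (hgrad : ∀ᵐ x ∂volume.restrict S, ∇ u₁ x = ∇ u₂ x) :
    ∃ C, ∀ x ∈ S, u₁ x = u₂ x + C := by
  obtain ⟨C, hC⟩ := exists_eq_const_of_ae_hasFDerivAt_zero volume (hu₁.sub hu₂) isOpen_interior
    hS.connected.isPreconnected (by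
      filter_upwards [(ae_restrict_iff' hS.measurableSet).1 hgrad,
        ae_differentiableAt_of_locallyLipschitz volume hu₁,
        ae_differentiableAt_of_locallyLipschitz volume hu₂] with x hx hd₁ hd₂ hxS
      have hsub := hd₁.hasFDerivAt.sub hd₂.hasFDerivAt
      rwa [← toDual_gradient, ← toDual_gradient, hx (interior_subset hxS), sub_self] at hsub)
  have hclosed : IsClosed {x | u₁ x - u₂ x = C} :=
    isClosed_eq (hu₁.continuous.sub hu₂.continuous) continuous_const
  exact ⟨C, fun x hx => sub_eq_iff_eq_add'.1 <|
    closure_minimal (s := interior S) hC hclosed (hS.subset_closure hx)⟩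

section CConcave

theorem IsCConcave.ae_differentiableAt_biTransform (hψ : IsCConcave S (diffCost h) ψ)
    (hh : ConvexOn ℝ univ h) (hS : IsCompact (closure S)) (hne : S.Nonempty) (hac : μ ≪ volume) :
    ∀ᵐ x ∂μ, DifferentiableAt ℝ (biTransform (diffCost h) S ψ) x := by
  have hc := locallyLipschitz_uncurry_diffCost hh.locallyLipschitz
  exact hac.ae_le <| ae_differentiableAt_of_locallyLipschitz volume <|
    locallyLipschitz_biTransform hc hS hne (hψ.bddAbove_image hc.continuous hS)

theorem IsCConcave.contactSet_eq (hψ : IsCConcave S (diffCost h) ψ)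
    (hh : StrictConvexOn ℝ univ h) (hS : IsCompact (closure S)) (hne : S.Nonempty)
    (hd : DifferentiableAt ℝ (biTransform (diffCost h) S ψ) x) :
    contactSet (diffCost h) S (infTransform (flip (diffCost h)) S ψ) x =
      {gradientMap h (biTransform (diffCost h) S ψ) x} := by
  have hc := (locallyLipschitz_uncurry_diffCost hh.convexOn.locallyLipschitz).continuous
  exact contactSet_eq_singleton_gradientMap hh hS hne
    (continuous_infTransform_flip hc hS hne (hψ.bddAbove_image hc hS)) hd

theorem IsCConcave.ae_contactSet_eq (hψ : IsCConcave S (diffCost h) ψ)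
    (hh : StrictConvexOn ℝ univ h) (hS : IsCompact (closure S)) (hne : S.Nonempty)
    (hac : μ ≪ volume) :
    ∀ᵐ x ∂μ, contactSet (diffCost h) S (infTransform (flip (diffCost h)) S ψ) x =
      {gradientMap h (biTransform (diffCost h) S ψ) x} :=
  (hψ.ae_differentiableAt_biTransform hh.convexOn hS hne hac).mono
    fun _ hx => hψ.contactSet_eq hh hS hne hx

theorem IsCConcave.isOptimalMap [IsFiniteMeasure μ] (hψ : IsCConcave S (diffCost h) ψ)
    (hh : StrictConvexOn ℝ univ h) (hh₀ : ∀ z, 0 ≤ h z) (hS : IsCompact (closure S))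
    (hne : S.Nonempty) (hμ : ∀ᵐ x ∂μ, x ∈ S)
    (hreg : ∀ᵐ x ∂μ, UniqueDiffWithinAt ℝ S x ∧
      DifferentiableAt ℝ (biTransform (diffCost h) S ψ) x)
    (hT : ∀ᵐ x ∂μ, T x = x - ∇ (legendre h) (gradientWithin ψ S x)) :
    IsOptimalMap (diffCost h) μ (μ.map T) T := by
  have hc := (locallyLipschitz_uncurry_diffCost hh.convexOn.locallyLipschitz).continuous
  have hTae : T =ᵐ[μ] gradientMap h (biTransform (diffCost h) S ψ) := by
    filter_upwards [hT, hμ, hreg] with x hTx hxS hx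
    rw [hTx, gradientWithin_eq_gradient_of_eqOn (hψ.eqOn_biTransform hc hS) hxS hx.1 hx.2,
      gradientMap]
  refine isOptimalMap_of_mem_contactSet hc (fun x y => hh₀ (x - y)) hS hne hμ
    (continuous_infTransform_flip hc hS hne (hψ.bddAbove_image hc hS))
    ((measurable_gradientMap _ _).aemeasurable.congr hTae.symm) ?_
  filter_upwards [hTae, hreg] with x hTx hx
  rw [hψ.contactSet_eq hh hS hne hx.2, hTx]
  exact mem_singleton _

theorem ae_uniqueDiffWithinAt (hSm : MeasurableSet S) (hμ : ∀ᵐ x ∂μ, x ∈ S) (hac : μ ≪ volume) :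
    ∀ᵐ x ∂μ, UniqueDiffWithinAt ℝ S x := by
  filter_upwards [hμ, hac.ae_le ((ae_restrict_iff' hSm).1
    (ae_restrict_uniqueDiffWithinAt volume hSm))] with x hxS hx using hx hxS

theorem IsCConcave.uniqueDiffWithinAt_and_differentiableAt_biTransform
    (hψ : IsCConcave S (diffCost h) ψ) (hh : ConvexOn ℝ univ h) (hS : IsCompact (closure S))
    (hx : x ∈ interior S) (hd : DifferentiableAt ℝ ψ x) :
    UniqueDiffWithinAt ℝ S x ∧ DifferentiableAt ℝ (biTransform (diffCost h) S ψ) x := by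
  have hc := (locallyLipschitz_uncurry_diffCost hh.locallyLipschitz).continuous
  have hnhds : S ∈ 𝓝 x := mem_interior_iff_mem_nhds.1 hx
  exact ⟨uniqueDiffWithinAt_of_mem_nhds hnhds,
    hd.congr_of_eventuallyEq ((hψ.eqOn_biTransform hc hS).eventuallyEq_of_mem hnhds).symm⟩

theorem IsCConcave.ae_uniqueDiffWithinAt_and_differentiableAt_biTransform
    (hψ : IsCConcave S (diffCost h) ψ) (hh : ConvexOn ℝ univ h) (hSm : MeasurableSet S)
    (hS : IsCompact (closure S)) (hne : S.Nonempty) (hμ : ∀ᵐ x ∂μ, x ∈ S) (hac : μ ≪ volume) :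
    ∀ᵐ x ∂μ, UniqueDiffWithinAt ℝ S x ∧ DifferentiableAt ℝ (biTransform (diffCost h) S ψ) x :=
  (ae_uniqueDiffWithinAt hSm hμ hac).and (hψ.ae_differentiableAt_biTransform hh hS hne hac)

theorem IsCConcave.ae_gradientWithin_eq_gradient (hψ : IsCConcave S (diffCost h) ψ)
    (hh : ConvexOn ℝ univ h) (hSm : MeasurableSet S) (hS : IsCompact (closure S))
    (hne : S.Nonempty) (hμ : ∀ᵐ x ∂μ, x ∈ S) (hac : μ ≪ volume) :
    ∀ᵐ x ∂μ, gradientWithin ψ S x = ∇ (biTransform (diffCost h) S ψ) x := by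
  have hc := (locallyLipschitz_uncurry_diffCost hh.locallyLipschitz).continuous
  filter_upwards [hμ, hψ.ae_uniqueDiffWithinAt_and_differentiableAt_biTransform hh hSm hS hne hμ
    hac] with x hxS hx
  exact gradientWithin_eq_gradient_of_eqOn (hψ.eqOn_biTransform hc hS) hxS hx.1 hx.2

theorem IsCConcave.ae_differentiableWithinAt (hψ : IsCConcave S (diffCost h) ψ)
    (hh : ConvexOn ℝ univ h) (hS : IsCompact (closure S)) (hne : S.Nonempty)
    (hμ : ∀ᵐ x ∂μ, x ∈ S) (hac : μ ≪ volume) : ∀ᵐ x ∂μ, DifferentiableWithinAt ℝ ψ S x := by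
  have hc := (locallyLipschitz_uncurry_diffCost hh.locallyLipschitz).continuous
  have heq := hψ.eqOn_biTransform hc hS
  filter_upwards [hμ, hψ.ae_differentiableAt_biTransform hh hS hne hac] with x hxS hx
  exact hx.differentiableWithinAt.congr heq (heq hxS)

theorem IsCConcave.exists_eq_add_const (hψ₁ : IsCConcave S (diffCost h) ψ₁)
    (hψ₂ : IsCConcave S (diffCost h) ψ₂) (hh : ConvexOn ℝ univ h) (hdom : IsTransportDomain S)
    (hS : IsCompact (closure S))
    (hgrad : ∀ᵐ x ∂volume.restrict S, gradientWithin ψ₁ S x = gradientWithin ψ₂ S x) :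
    ∃ C, ∀ x ∈ S, ψ₁ x = ψ₂ x + C := by
  have hc := locallyLipschitz_uncurry_diffCost hh.locallyLipschitz
  have hne : S.Nonempty := hdom.connected.nonempty.mono interior_subset
  have hmem := ae_restrict_mem (μ := volume) hdom.measurableSet
  have hac : volume.restrict S ≪ (volume : Measure (Space d)) :=
    Measure.restrict_le_self.absolutelyContinuous
  obtain ⟨C, hC⟩ := exists_eq_add_const_of_ae_gradient_eq hdom
    (locallyLipschitz_biTransform hc hS hne (hψ₁.bddAbove_image hc.continuous hS))
    (locallyLipschitz_biTransform hc hS hne (hψ₂.bddAbove_image hc.continuous hS)) (by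
      filter_upwards [hgrad,
        hψ₁.ae_gradientWithin_eq_gradient hh hdom.measurableSet hS hne hmem hac,
        hψ₂.ae_gradientWithin_eq_gradient hh hdom.measurableSet hS hne hmem hac]
        with x hx hx₁ hx₂
      rw [← hx₁, ← hx₂, hx])
  refine ⟨C, fun x hx => ?_⟩
  rw [hψ₁.eqOn_biTransform hc.continuous hS hx, hψ₂.eqOn_biTransform hc.continuous hS hx, hC x hx]

end CConcave

section Potential

variable [IsProbabilityMeasure μ] [IsProbabilityMeasure ν]

theorem IsKantorovichPotential.isOptimalMap_gradientMap
    (hψ : IsKantorovichPotential S (diffCost h) μ ν ψ) (hh : StrictConvexOn ℝ univ h)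
    (hh₀ : ∀ z, 0 ≤ h z) (hS : IsCompact (closure S)) (hμ : ∀ᵐ x ∂μ, x ∈ S)
    (hν : ∀ᵐ y ∂ν, y ∈ S) (hac : μ ≪ volume) :
    IsOptimalMap (diffCost h) μ ν (gradientMap h (biTransform (diffCost h) S ψ)) :=
  hψ.isOptimalMap (locallyLipschitz_uncurry_diffCost hh.convexOn.locallyLipschitz).continuous
    (fun x y => hh₀ (x - y)) hS hμ hν (measurable_gradientMap _ _).aemeasurable
    (hψ.1.1.ae_contactSet_eq hh hS hμ.exists hac)

theorem IsKantorovichPotential.eq_mapPlan_gradientMap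
    (hψ : IsKantorovichPotential S (diffCost h) μ ν ψ) (hh : StrictConvexOn ℝ univ h)
    (hh₀ : ∀ z, 0 ≤ h z) (hS : IsCompact (closure S)) (hμ : ∀ᵐ x ∂μ, x ∈ S)
    (hν : ∀ᵐ y ∂ν, y ∈ S) (hac : μ ≪ volume) {γ : Measure (Space d × Space d)}
    (hγ : IsOptimalPlan (diffCost h) μ ν γ) :
    γ = mapPlan μ (gradientMap h (biTransform (diffCost h) S ψ)) :=
  hψ.eq_mapPlan (locallyLipschitz_uncurry_diffCost hh.convexOn.locallyLipschitz).continuous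
    (fun x y => hh₀ (x - y)) hS hμ hν (measurable_gradientMap _ _)
    (hψ.1.1.ae_contactSet_eq hh hS hμ.exists hac) hγ

theorem IsKantorovichPotential.ae_eq_gradientMap
    (hψ : IsKantorovichPotential S (diffCost h) μ ν ψ) (hh : StrictConvexOn ℝ univ h)
    (hh₀ : ∀ z, 0 ≤ h z) (hS : IsCompact (closure S)) (hμ : ∀ᵐ x ∂μ, x ∈ S)
    (hν : ∀ᵐ y ∂ν, y ∈ S) (hac : μ ≪ volume) (hT : IsOptimalMap (diffCost h) μ ν T) :
    T =ᵐ[μ] gradientMap h (biTransform (diffCost h) S ψ) :=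
  hψ.ae_eq_of_isOptimalMap
    (locallyLipschitz_uncurry_diffCost hh.convexOn.locallyLipschitz).continuous
    (fun x y => hh₀ (x - y)) hS hμ hν (measurable_gradientMap _ _)
    (hψ.1.1.ae_contactSet_eq hh hS hμ.exists hac) hT

theorem IsKantorovichPotential.ae_mem_contactSet
    (hψ : IsKantorovichPotential S (diffCost h) μ ν ψ) (hh : StrictConvexOn ℝ univ h)
    (hh₀ : ∀ z, 0 ≤ h z) (hS : IsCompact (closure S)) (hμ : ∀ᵐ x ∂μ, x ∈ S)
    (hν : ∀ᵐ y ∂ν, y ∈ S) (hac : μ ≪ volume) (hT : IsOptimalMap (diffCost h) μ ν T) :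
    ∀ᵐ x ∂μ, T x ∈ contactSet (diffCost h) S (infTransform (flip (diffCost h)) S ψ) x := by
  filter_upwards [hψ.ae_eq_gradientMap hh hh₀ hS hμ hν hac hT,
    hψ.1.1.ae_contactSet_eq hh hS hμ.exists hac] with x hx hcontact
  rw [hcontact, hx]
  exact mem_singleton _

theorem IsKantorovichPotential.ae_add_cConj_eq
    (hψ : IsKantorovichPotential S (diffCost h) μ ν ψ) (hh : StrictConvexOn ℝ univ h)
    (hh₀ : ∀ z, 0 ≤ h z) (hS : IsCompact (closure S)) (hμ : ∀ᵐ x ∂μ, x ∈ S)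
    (hν : ∀ᵐ y ∂ν, y ∈ S) (hac : μ ≪ volume) (hT : IsOptimalMap (diffCost h) μ ν T) :
    ∀ᵐ x ∂μ, (ψ x : EReal) + cConj S (diffCost h) ψ (T x) = (diffCost h x (T x) : ℝ) := by
  have hc := (locallyLipschitz_uncurry_diffCost hh.convexOn.locallyLipschitz).continuous
  filter_upwards [hμ, hψ.ae_mem_contactSet hh hh₀ hS hμ hν hac hT] with x hxS hx
  exact hψ.1.1.add_cConj_eq hc hS hxS hx

theorem IsKantorovichPotential.ae_isSubgradient_gradientWithin
    (hψ : IsKantorovichPotential S (diffCost h) μ ν ψ) (hh : StrictConvexOn ℝ univ h)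
    (hh₀ : ∀ z, 0 ≤ h z) (hSm : MeasurableSet S) (hS : IsCompact (closure S))
    (hμ : ∀ᵐ x ∂μ, x ∈ S) (hν : ∀ᵐ y ∂ν, y ∈ S) (hac : μ ≪ volume)
    (hT : IsOptimalMap (diffCost h) μ ν T) :
    ∀ᵐ x ∂μ, IsSubgradient h (gradientWithin ψ S x) (x - T x) := by
  have hc := (locallyLipschitz_uncurry_diffCost hh.convexOn.locallyLipschitz).continuous
  filter_upwards [hψ.1.1.ae_gradientWithin_eq_gradient hh.convexOn hSm hS hμ.exists hμ hac,
    hψ.1.1.ae_differentiableAt_biTransform hh.convexOn hS hμ.exists hac,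
    hψ.ae_mem_contactSet hh hh₀ hS hμ hν hac hT] with x hgrad hd hcontact
  rw [hgrad]
  exact isSubgradient_gradient_infTransform hh.convexOn hS
    (continuous_infTransform_flip hc hS hμ.exists (hψ.1.1.bddAbove_image hc hS)) hd hcontact

theorem IsKantorovichPotential.ae_eq_sub_gradient_legendre
    (hψ : IsKantorovichPotential S (diffCost h) μ ν ψ) (hh : StrictConvexOn ℝ univ h)
    (hh₀ : ∀ z, 0 ≤ h z) (hSm : MeasurableSet S) (hS : IsCompact (closure S))
    (hμ : ∀ᵐ x ∂μ, x ∈ S) (hν : ∀ᵐ y ∂ν, y ∈ S) (hac : μ ≪ volume)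
    (hT : IsOptimalMap (diffCost h) μ ν T) :
    ∀ᵐ x ∂μ, gradientWithin ψ S x ∈ interior (legendreDom h) ∧
      DifferentiableAt ℝ (legendre h) (gradientWithin ψ S x) ∧
      T x = x - ∇ (legendre h) (gradientWithin ψ S x) := by
  filter_upwards [hψ.ae_isSubgradient_gradientWithin hh hh₀ hSm hS hμ hν hac hT] with x hsub
  have hgrad := hsub.hasGradientAt_legendre hh
  exact ⟨hsub.mem_interior_legendreDom hh, hgrad.differentiableAt,
    by rw [hgrad.gradient, sub_sub_cancel]⟩

theorem IsKantorovichPotential.ae_gradientWithin_eq_gradient_sub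
    (hψ : IsKantorovichPotential S (diffCost h) μ ν ψ) (hh : StrictConvexOn ℝ univ h)
    (hh₀ : ∀ z, 0 ≤ h z) (hSm : MeasurableSet S) (hS : IsCompact (closure S))
    (hμ : ∀ᵐ x ∂μ, x ∈ S) (hν : ∀ᵐ y ∂ν, y ∈ S) (hac : μ ≪ volume)
    (hT : IsOptimalMap (diffCost h) μ ν T) :
    ∀ᵐ x ∂μ, DifferentiableAt ℝ h (x - T x) → gradientWithin ψ S x = ∇ h (x - T x) :=
  (hψ.ae_isSubgradient_gradientWithin hh hh₀ hSm hS hμ hν hac hT).mono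
    fun _ hx hd => hx.eq_gradient hd

theorem IsKantorovichPotential.ae_gradientWithin_eq_gradientWithin
    (hψ₁ : IsKantorovichPotential S (diffCost h) μ ν ψ₁)
    (hψ₂ : IsKantorovichPotential S (diffCost h) μ ν ψ₂) (hh : StrictConvexOn ℝ univ h)
    (hh₀ : ∀ z, 0 ≤ h z) (hSm : MeasurableSet S) (hS : IsCompact (closure S))
    (hμ : ∀ᵐ x ∂μ, x ∈ S) (hν : ∀ᵐ y ∂ν, y ∈ S) (hac : μ ≪ volume)
    (hT : IsOptimalMap (diffCost h) μ ν T) :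
    ∀ᵐ x ∂μ, DifferentiableAt ℝ h (x - T x) → gradientWithin ψ₁ S x = gradientWithin ψ₂ S x := by
  filter_upwards [hψ₁.ae_gradientWithin_eq_gradient_sub hh hh₀ hSm hS hμ hν hac hT,
    hψ₂.ae_gradientWithin_eq_gradient_sub hh hh₀ hSm hS hμ hν hac hT] with x hx₁ hx₂ hd
  rw [hx₁ hd, hx₂ hd]

end Potential

end DifferenceCosts

section Quadratic

open Function

variable {d : ℕ} {S : Set (Space d)} {μ ν : Measure (Space d)} {f φ ψ : Space d → ℝ}
  {T : Space d → Space d} {x : Space d}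

theorem quadratic_nonneg (z : Space d) : 0 ≤ quadratic z := by
  rw [quadratic]
  positivity

theorem quadratic_sub (x y : Space d) :
    quadratic (x - y) = quadratic x - inner ℝ x y + quadratic y := by
  simp only [quadratic, norm_sub_sq_real]
  ring

theorem hasGradientAt_quadratic (x : Space d) : HasGradientAt quadratic x x := by
  rw [hasGradientAt_iff_hasFDerivAt]
  convert! (hasStrictFDerivAt_norm_sq x).hasFDerivAt.const_mul (2⁻¹ : ℝ) using 1
  · ext y
    exact div_eq_inv_mul _ _
  · ext v
    simp

theorem strictConvexOn_quadratic : StrictConvexOn ℝ univ (quadratic : Space d → ℝ) := by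
  refine StrongConvexOn.strictConvexOn (m := 1) (strongConvexOn_iff_convex.2 ?_) one_pos
  exact (convexOn_const (0 : ℝ) convex_univ).congr fun x _ => by simp only [quadratic]; ring

theorem continuous_uncurry_diffCost_quadratic :
    Continuous (uncurry (diffCost (quadratic : Space d → ℝ))) :=
  (locallyLipschitz_uncurry_diffCost strictConvexOn_quadratic.convexOn.locallyLipschitz).continuous

-- This function is the supremum over `w ∈ S` of the affine functions `⟪·, w⟫ - |w|²/2 + f w`.
theorem convexOn_quadratic_sub_infTransform (hS : IsCompact (closure S)) (hne : S.Nonempty)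
    (hf : BddAbove (f '' S)) :
    ConvexOn ℝ univ fun x => quadratic x - infTransform (diffCost quadratic) S f x := by
  refine ⟨convex_univ, fun x _ y _ a b ha hb hab => sub_le_comm.1 (le_infTransform hne ?_)⟩
  intro w hw
  have hx := mul_le_mul_of_nonneg_left
    (infTransform_le continuous_uncurry_diffCost_quadratic hS hf x hw) ha
  have hy := mul_le_mul_of_nonneg_left
    (infTransform_le continuous_uncurry_diffCost_quadratic hS hf y hw) hb
  obtain rfl := eq_sub_of_add_eq' hab
  simp only [diffCost, quadratic_sub, inner_add_left, real_inner_smul_left, smul_eq_mul] at hx hy ⊢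
  linarith

/-- The convex function `|x|²/2 - ψ(x)` of Brenier's theorem. Since `ψ` matters on `S` only, it is
replaced by its double transform, which is defined on the whole space. -/
noncomputable def brenierPotential (S : Set (Space d)) (ψ : Space d → ℝ) (x : Space d) : ℝ :=
  quadratic x - biTransform (diffCost quadratic) S ψ x

theorem IsCConcave.brenierPotential_eq (hψ : IsCConcave S (diffCost quadratic) ψ)
    (hS : IsCompact (closure S)) (hx : x ∈ S) : brenierPotential S ψ x = ‖x‖ ^ 2 / 2 - ψ x := by
  rw [hψ.eqOn_biTransform continuous_uncurry_diffCost_quadratic hS hx, brenierPotential, quadratic]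

theorem IsCConcave.convexOn_brenierPotential (hψ : IsCConcave S (diffCost quadratic) ψ)
    (hS : IsCompact (closure S)) (hne : S.Nonempty) : ConvexOn ℝ univ (brenierPotential S ψ) :=
  have hc := continuous_uncurry_diffCost_quadratic
  convexOn_quadratic_sub_infTransform hS hne <| bddAbove_image_of_isCompact_closure hS <|
    continuous_infTransform_flip hc hS hne (hψ.bddAbove_image hc hS)

theorem hasGradientAt_brenierPotential
    (hd : DifferentiableAt ℝ (biTransform (diffCost quadratic) S ψ) x) :
    HasGradientAt (brenierPotential S ψ)
      (x - ∇ (biTransform (diffCost quadratic) S ψ) x) x := by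
  rw [hasGradientAt_iff_hasFDerivAt, map_sub]
  exact (hasGradientAt_quadratic x).hasFDerivAt.sub hd.hasGradientAt.hasFDerivAt

theorem IsCConcave.ae_contactSet_eq_gradient_brenierPotential
    (hψ : IsCConcave S (diffCost quadratic) ψ) (hS : IsCompact (closure S)) (hne : S.Nonempty)
    (hac : μ ≪ volume) :
    ∀ᵐ x ∂μ, contactSet (diffCost quadratic) S (infTransform (flip (diffCost quadratic)) S ψ) x =
      {∇ (brenierPotential S ψ) x} := by
  have hc := continuous_uncurry_diffCost_quadratic (d := d)
  have hq := (strictConvexOn_quadratic (d := d)).convexOn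
  have hconj := continuous_infTransform_flip hc hS hne (hψ.bddAbove_image hc hS)
  filter_upwards [hψ.ae_differentiableAt_biTransform hq hS hne hac] with x hd
  refine eq_singleton_iff_nonempty_unique_mem.2
    ⟨nonempty_contactSet hc hS hne hconj x, fun y hy => ?_⟩
  have hgrad := (isSubgradient_gradient_infTransform hq hS hconj hd hy).eq_gradient
    (hasGradientAt_quadratic _).differentiableAt
  rw [(hasGradientAt_brenierPotential hd).gradient, biTransform, hgrad,
    (hasGradientAt_quadratic _).gradient, sub_sub_cancel]

theorem mem_contactSet_flip_gradient_of_convexOn (hS : IsCompact (closure S))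
    (hφ : ConvexOn ℝ univ φ) (hx : x ∈ S) (hd : DifferentiableAt ℝ φ x) :
    x ∈ contactSet (flip (diffCost quadratic)) S (fun z => quadratic z - φ z) (∇ φ x) := by
  have hu : Continuous fun z => quadratic z - φ z :=
    strictConvexOn_quadratic.convexOn.locallyLipschitz.continuous.sub
      hφ.locallyLipschitz.continuous
  have hsub : IsSubgradient φ (∇ φ x) x :=
    isSubgradient_of_sub_le_sub hφ hd.hasGradientAt fun _ => le_rfl
  refine ⟨subset_closure hx, le_antisymm (infTransform_add_le_of_mem_closure
    (continuous_uncurry_flip continuous_uncurry_diffCost_quadratic) hS hu _ (subset_closure hx))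
    (sub_le_iff_le_add.1 (le_infTransform ⟨x, hx⟩ fun z _ => ?_))⟩
  have hz := hsub (z - x)
  rw [add_sub_cancel, inner_sub_right, real_inner_comm z, real_inner_comm x] at hz
  simp only [flip, diffCost, quadratic_sub]
  linarith

theorem isOptimalMap_gradient_of_convexOn [IsFiniteMeasure μ] (hS : IsCompact (closure S))
    (hne : S.Nonempty) (hμ : ∀ᵐ x ∂μ, x ∈ S) (hac : μ ≪ volume) (hφ : ConvexOn ℝ univ φ)
    (hν : ∀ᵐ y ∂μ.map (∇ φ), y ∈ S) :
    IsOptimalMap (diffCost quadratic) μ (μ.map (∇ φ)) (∇ φ) := by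
  have hc := continuous_uncurry_diffCost_quadratic (d := d)
  have hu : Continuous fun z => quadratic z - φ z :=
    strictConvexOn_quadratic.convexOn.locallyLipschitz.continuous.sub
      hφ.locallyLipschitz.continuous
  have hm := (measurable_gradient φ).aemeasurable (μ := μ)
  refine isOptimalMap_of_mem_contactSet hc (fun x y => quadratic_nonneg (x - y)) hS hne hμ
    (continuous_infTransform_flip hc hS hne (bddAbove_image_of_isCompact_closure hS hu)) hm ?_
  filter_upwards [hμ, ae_of_ae_map hm hν, hac.ae_le <|
    ae_differentiableAt_of_locallyLipschitz volume hφ.locallyLipschitz] with x hx hgrad hd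
  exact mem_contactSet_of_mem_contactSet_flip hc hS hu hx (subset_closure hgrad)
    (mem_contactSet_flip_gradient_of_convexOn hS hφ hx hd)

section Potential

variable [IsProbabilityMeasure μ] [IsProbabilityMeasure ν]

theorem IsKantorovichPotential.ae_eq_sub_gradientWithin
    (hψ : IsKantorovichPotential S (diffCost quadratic) μ ν ψ) (hSm : MeasurableSet S)
    (hS : IsCompact (closure S)) (hμ : ∀ᵐ x ∂μ, x ∈ S) (hν : ∀ᵐ y ∂ν, y ∈ S)
    (hac : μ ≪ volume) (hT : IsOptimalMap (diffCost quadratic) μ ν T) :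
    ∀ᵐ x ∂μ, T x = x - gradientWithin ψ S x := by
  filter_upwards [hψ.ae_gradientWithin_eq_gradient_sub strictConvexOn_quadratic quadratic_nonneg
    hSm hS hμ hν hac hT] with x hx
  rw [hx (hasGradientAt_quadratic _).differentiableAt, (hasGradientAt_quadratic _).gradient,
    sub_sub_cancel]

theorem IsKantorovichPotential.isOptimalMap_gradient_brenierPotential
    (hψ : IsKantorovichPotential S (diffCost quadratic) μ ν ψ) (hS : IsCompact (closure S))
    (hμ : ∀ᵐ x ∂μ, x ∈ S) (hν : ∀ᵐ y ∂ν, y ∈ S) (hac : μ ≪ volume) :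
    IsOptimalMap (diffCost quadratic) μ ν (∇ (brenierPotential S ψ)) :=
  hψ.isOptimalMap continuous_uncurry_diffCost_quadratic (fun x y => quadratic_nonneg (x - y)) hS
    hμ hν (measurable_gradient _).aemeasurable
    (hψ.1.1.ae_contactSet_eq_gradient_brenierPotential hS hμ.exists hac)

theorem IsKantorovichPotential.gradient_ae_eq_of_map_eq
    (hψ : IsKantorovichPotential S (diffCost quadratic) μ ν ψ) (hS : IsCompact (closure S))
    (hμ : ∀ᵐ x ∂μ, x ∈ S) (hν : ∀ᵐ y ∂ν, y ∈ S) (hac : μ ≪ volume) (hφ : ConvexOn ℝ univ φ)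
    (hmap : μ.map (∇ φ) = ν) : ∇ φ =ᵐ[μ] ∇ (brenierPotential S ψ) :=
  hψ.ae_eq_of_isOptimalMap continuous_uncurry_diffCost_quadratic
    (fun x y => quadratic_nonneg (x - y)) hS hμ hν (measurable_gradient _)
    (hψ.1.1.ae_contactSet_eq_gradient_brenierPotential hS hμ.exists hac)
    (hmap ▸ isOptimalMap_gradient_of_convexOn hS hμ.exists hμ hac hφ (hmap.symm ▸ hν))

end Potential

end Quadratic

end OptTransport

open OptTransport Filter Topology

theorem mainTheorem2 {d : ℕ} (Ω : Set (OptTransport.Space d))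
    (hΩ : OptTransport.IsTransportDomain Ω)
    (h : OptTransport.Space d → ℝ) (h_convex : StrictConvexOn ℝ Set.univ h)
    (h_nonneg : ∀ z, 0 ≤ h z)
    (μ ν : Measure (OptTransport.Space d)) [IsProbabilityMeasure μ] [IsProbabilityMeasure ν]
    (hμ : μ Ωᶜ = 0) (hν : ν Ωᶜ = 0) :
    -- an optimal plan exists
    (∃ γ, OptTransport.IsOptimalPlan (OptTransport.diffCost h) μ ν γ) ∧
    (Bornology.IsBounded Ω →
      -- a Kantorovich potential exists
      (∃ ψ, OptTransport.IsKantorovichPotential Ω (OptTransport.diffCost h) μ ν ψ) ∧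
      (μ ≪ volume →
        ∃ T : OptTransport.Space d → OptTransport.Space d, Measurable T ∧
          -- the optimal plan is unique and induced by `T`
          OptTransport.IsOptimalMap (OptTransport.diffCost h) μ ν T ∧
          (∀ γ, OptTransport.IsOptimalPlan (OptTransport.diffCost h) μ ν γ →
            γ = OptTransport.mapPlan μ T) ∧
          -- link between `T` and every Kantorovich potential
          (∀ ψ, OptTransport.IsKantorovichPotential Ω (OptTransport.diffCost h) μ ν ψ →
            ∀ᵐ x ∂μ, DifferentiableWithinAt ℝ ψ Ω x ∧
              gradientWithin ψ Ω x ∈ interior (OptTransport.legendreDom h) ∧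
              DifferentiableAt ℝ (OptTransport.legendre h) (gradientWithin ψ Ω x) ∧
              T x = x - ∇ (OptTransport.legendre h) (gradientWithin ψ Ω x) ∧
              (ψ x : EReal) + OptTransport.cConj Ω (OptTransport.diffCost h) ψ (T x)
                = (OptTransport.diffCost h x (T x) : ℝ)) ∧
          -- the gradient of the potential is unique wherever `h` is differentiable at `x - T x`
          (∀ ψ₁ ψ₂, OptTransport.IsKantorovichPotential Ω (OptTransport.diffCost h) μ ν ψ₁ →
            OptTransport.IsKantorovichPotential Ω (OptTransport.diffCost h) μ ν ψ₂ →
            ∀ᵐ x ∂μ, DifferentiableAt ℝ h (x - T x) →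
              gradientWithin ψ₁ Ω x = gradientWithin ψ₂ Ω x) ∧
          -- the potential is unique up to constants if the density of `μ` is positive a.e. on `Ω`
          ((∀ᵐ x ∂μ, DifferentiableAt ℝ h (x - T x)) → volume.restrict Ω ≪ μ →
            ∀ ψ₁ ψ₂, OptTransport.IsKantorovichPotential Ω (OptTransport.diffCost h) μ ν ψ₁ →
              OptTransport.IsKantorovichPotential Ω (OptTransport.diffCost h) μ ν ψ₂ →
              ∃ C : ℝ, ∀ x ∈ Ω, ψ₁ x = ψ₂ x + C)) ∧
      -- converse: maps of this form are optimal between `μ` and their image measure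
      (∀ (ψ : OptTransport.Space d → ℝ) (T : OptTransport.Space d → OptTransport.Space d),
        OptTransport.IsCConcave Ω (OptTransport.diffCost h) ψ →
        (μ ≪ volume ∨ ∀ᵐ x ∂μ, x ∈ interior Ω ∧ DifferentiableAt ℝ ψ x) →
        (∀ᵐ x ∂μ, T x = x - ∇ (OptTransport.legendre h) (gradientWithin ψ Ω x)) →
        OptTransport.IsOptimalMap (OptTransport.diffCost h) μ (μ.map T) T) ∧
      -- Brenier's theorem: the quadratic cost
      (μ ≪ volume →
        ∃ φ : OptTransport.Space d → ℝ, ConvexOn ℝ Set.univ φ ∧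
          OptTransport.IsOptimalMap (OptTransport.diffCost OptTransport.quadratic) μ ν (∇ φ) ∧
          (∃ ψ, OptTransport.IsKantorovichPotential Ω
              (OptTransport.diffCost OptTransport.quadratic) μ ν ψ ∧
            ∀ x ∈ Ω, φ x = ‖x‖ ^ 2 / 2 - ψ x) ∧
          (∀ ψ, OptTransport.IsKantorovichPotential Ω
              (OptTransport.diffCost OptTransport.quadratic) μ ν ψ →
            ∀ᵐ x ∂μ, ∇ φ x = x - gradientWithin ψ Ω x) ∧
          (∀ φ' : OptTransport.Space d → ℝ, ConvexOn ℝ Set.univ φ' → μ.map (∇ φ') = ν →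
            ∀ᵐ x ∂μ, ∇ φ' x = ∇ φ x))) := by
  have hne : Ω.Nonempty := hΩ.connected.nonempty.mono interior_subset
  have hm := hΩ.measurableSet
  have hh := h_convex.convexOn
  have hc := (locallyLipschitz_uncurry_diffCost hh.locallyLipschitz).continuous
  refine ⟨exists_isOptimalPlan μ ν hc, fun hb => ?_⟩
  have hS := hb.isCompact_closure
  obtain ⟨ψ₀, hψ₀⟩ := exists_isKantorovichPotential hc hS hμ hν
  refine ⟨⟨ψ₀, hψ₀⟩, fun hac => ?_, fun ψ T hψ hreg hT => ?_, fun hac => ?_⟩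
  · have hopt := hψ₀.isOptimalMap_gradientMap h_convex h_nonneg hS hμ hν hac
    refine ⟨_, measurable_gradientMap _ _, hopt, fun γ hγ =>
      hψ₀.eq_mapPlan_gradientMap h_convex h_nonneg hS hμ hν hac hγ, fun ψ hψ => ?_,
      fun _ _ h₁ h₂ =>
        h₁.ae_gradientWithin_eq_gradientWithin h₂ h_convex h_nonneg hm hS hμ hν hac hopt,
      fun hd hpos ψ₁ ψ₂ h₁ h₂ => h₁.1.1.exists_eq_add_const h₂.1.1 hh hΩ hS <| hpos.ae_le <|
        hd.mp (h₁.ae_gradientWithin_eq_gradientWithin h₂ h_convex h_nonneg hm hS hμ hν hac hopt)⟩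
    filter_upwards [hψ.1.1.ae_differentiableWithinAt hh hS hne hμ hac,
      hψ.ae_eq_sub_gradient_legendre h_convex h_nonneg hm hS hμ hν hac hopt,
      hψ.ae_add_cConj_eq h_convex h_nonneg hS hμ hν hac hopt]
      with x hd hT hcontact using ⟨hd, hT.1, hT.2.1, hT.2.2, hcontact⟩
  · exact hψ.isOptimalMap h_convex h_nonneg hS hne hμ (hreg.elim
      (hψ.ae_uniqueDiffWithinAt_and_differentiableAt_biTransform hh hm hS hne hμ)
      fun hint => hint.mono fun _ hx =>
        hψ.uniqueDiffWithinAt_and_differentiableAt_biTransform hh hS hx.1 hx.2) hT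
  · obtain ⟨ψ, hψ⟩ := exists_isKantorovichPotential continuous_uncurry_diffCost_quadratic hS hμ hν
    have hopt := hψ.isOptimalMap_gradient_brenierPotential hS hμ hν hac
    exact ⟨_, hψ.1.1.convexOn_brenierPotential hS hne, hopt,
      ⟨ψ, hψ, fun x hx => hψ.1.1.brenierPotential_eq hS hx⟩,
      fun ψ' hψ' => hψ'.ae_eq_sub_gradientWithin hm hS hμ hν hac hopt,
      fun φ' hφ' hmap => hψ.gradient_ae_eq_of_map_eq hS hμ hν hac hφ' hmap⟩
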